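/- Let $F$ be a field of characteristic zero and let $(A,\Delta,d)$ be a differential Batalin–Vilkovisky algebra over $F$: $A=\bigoplus_{n\ge 0}A^n$ is a unital graded commutative associative $F$-algebra with a Gerstenhaber bracket $[\,,\,]$ (a graded Lie bracket of degree $-1$, bracketing with a homogeneous $a$ being a derivation of the product of degree $|a|-1$), $d$ is a differential of degree $+1$ and a derivation of the product, and $\Delta$ is an operator of degree $-1$ with $\Delta^2=0$, $\Delta d+d\Delta=0$ and $[a,b]=(-1)^{|a|}\bigl(\Delta(ab)-(\Delta a)b-(-1)^{|a|}a\,\Delta b\bigr)$. Let $g$ be the differential graded Lie algebra $(A,[\,,\,],d)$ with the grading $g_p=A^{1-p}$, and let $m=(\operatorname{Ker}\Delta,d)\subset g$. Assume that $(A,\Delta,d)$ satisfies the statement of the Kählerian Formality Lemma: the inclusion $m\hookrightarrow(g,d)$ and the projection $\mathrm{proj}:m\to (H(g,\Delta),0)$ are chain maps inducing isomorphisms on homology. Through these isomorphisms $H(g,\Delta)\cong H(m)\cong H(g)=H(g,d)$, regard $\mathrm{proj}$ as a map $m\to H(g)$. Assume moreover that $A^0=F\cdot 1$, that $\Delta(1)=0$,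 and that $H_1(g)\ne 0$. Put $\tilde g=\bigoplus_{n\ge 0}g_{-n}=\bigoplus_{n\ge 0}A^{n+1}$, the complement of the central copy $F\cdot 1=g_1$ of the ground field in $g=F\oplus\tilde g$. For a contraction $(H(g)\underset{\nabla}{\overset{\pi}{\leftrightarrows}} m,\,h)$ of $m$ onto $(H(g),0)$ (so $\pi,\nabla$ are chain maps of degree $0$, $h$ has degree $1$, $\pi\nabla=\mathrm{id}$, $dh+hd=\nabla\pi-\mathrm{id}$, $\pi h=0$, $h\nabla=0$, $hh=0$) with $\pi=\mathrm{proj}$, let $\tau=\sum_{k\ge1}\tau_k:S^c[sH(g)]\to g$, with $\tau_k$ the component on $S^c_k[sH(g)]$, be determined by $\tau_1=\nabla\tau_{H(g)}$ and $\tau_k=-\tfrac12 h\bigl([\tau_1,\tau_{k-1}]+\cdots+[\tau_{k-1},\tau_1]\bigr)$ for $k\ge 2$. Here $S^c[sH(g)]$ is the graded symmetric coalgebra on the suspension of $H(g)$, $\tau_{H(g)}:S^c[sH(g)]\to H(g)$ is the universal twisting cochain ($sx\mapsto x$, and zero on $S^c_k$ for $k\neq1$), and the brackets of cochains are cup brackets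 (with the Koszul sign rule). Then there is a contraction of $m$ onto $H(g)$ with $\pi=\mathrm{proj}$ such that the associated $\tau$ is homogeneous of degree $-1$, solves the master equation $d\tau=\tfrac12[\tau,\tau]$, satisfies $\Delta\tau=0$, $\pi\tau=\tau_{H(g)}$ and $\operatorname{Im}(\tau_k)\subset\operatorname{Im}(\Delta)$ for $k\ge2$, and moreover $$\operatorname{Im}(\tau_k)\subset\tilde g\qquad\text{for all }k\ge 2 .$$ -/

import Mathlib

open scoped TensorProduct DirectSum

namespace BVFormality

section Complexes

variable {F : Type*} [Field F]
variable {M : Type*} [AddCommGroup M] [Module F M]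
variable {N : Type*} [AddCommGroup N] [Module F N]

/-- The homology `ker d / im d` of an operator `d` (used only when `d ∘ d = 0`). -/
abbrev Homology (d : N →ₗ[F] N) : Type _ :=
  ↥(LinearMap.ker d) ⧸ (LinearMap.range d).submoduleOf (LinearMap.ker d)

/-- The homology class of a cycle. -/
def Homology.cls (d : N →ₗ[F] N) : ↥(LinearMap.ker d) →ₗ[F] Homology d :=
  ((LinearMap.range d).submoduleOf (LinearMap.ker d)).mkQ

/-- `H_p(N, d)` as a subspace of `H(N, d)`: the classes of the cycles of degree `p`. -/
def Homology.grading (𝒩 : ℤ → Submodule F N) (d : N →ₗ[F] N) (p : ℤ) :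
    Submodule F (Homology d) :=
  ((𝒩 p).submoduleOf (LinearMap.ker d)).map (Homology.cls d)

/-- The map on homology induced by a chain map. -/
def Homology.map {dM : M →ₗ[F] M} {dN : N →ₗ[F] N} (f : M →ₗ[F] N)
    (hf : ∀ x, f (dM x) = dN (f x)) : Homology dM →ₗ[F] Homology dN :=
  Submodule.mapQ _ _
    (f.restrict (p := LinearMap.ker dM) (q := LinearMap.ker dN) (fun x hx => by
      rw [LinearMap.mem_ker] at hx ⊢
      rw [← hf, hx, map_zero]))
    (by
      rintro x ⟨y, hy⟩
      exact ⟨f y, by rw [← hf, hy]; rfl⟩)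

/-- The suspension of a graded space: `(sV)_p = V_{p-1}`. -/
def suspension (𝒩 : ℤ → Submodule F N) (p : ℤ) : Submodule F N := 𝒩 (p - 1)

/-- A contraction of the graded chain complex `(N, dN)` onto the graded chain complex `(M, dM)`
(differentials lower degrees by one): chain maps `π : N → M`, `∇ : M → N` and an operator `h` of
degree `1` on `N` with `π ∇ = id`, `dN h + h dN = ∇ π - id`, `π h = 0`, `h ∇ = 0`, `h h = 0`. -/
structure Contraction (ℳ : ℤ → Submodule F M) (dM : M →ₗ[F] M)
    (𝒩 : ℤ → Submodule F N) (dN : N →ₗ[F] N) where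
  proj : N →ₗ[F] M
  incl : M →ₗ[F] N
  h : N →ₗ[F] N
  proj_mem : ∀ p, ∀ x ∈ 𝒩 p, proj x ∈ ℳ p
  incl_mem : ∀ p, ∀ y ∈ ℳ p, incl y ∈ 𝒩 p
  h_mem : ∀ p, ∀ x ∈ 𝒩 p, h x ∈ 𝒩 (p + 1)
  proj_comm : ∀ x, proj (dN x) = dM (proj x)
  incl_comm : ∀ y, incl (dM y) = dN (incl y)
  proj_incl : ∀ y, proj (incl y) = y
  homotopy : ∀ x, dN (h x) + h (dN x) = incl (proj x) - x
  proj_h : ∀ x, proj (h x) = 0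
  h_incl : ∀ y, h (incl y) = 0
  h_h : ∀ x, h (h x) = 0

end Complexes

section SymmetricCoalgebra

variable {F : Type*} [Field F]
variable {V : Type*} [AddCommGroup V] [Module F V]

/-- The Koszul sign `ε(σ; p)` for which `v₁ ⋯ vₙ = ε(σ; p) v_{σ(1)} ⋯ v_{σ(n)}` in graded
commutative variables `vᵢ` of degrees `pᵢ`: one factor `(-1)^{p_{σ(i)} p_{σ(j)}}` for each
inversion `i < j`, `σ(j) < σ(i)`. -/
def koszulSign {n : ℕ} (σ : Equiv.Perm (Fin n)) (p : Fin n → ℤ) : ℤˣ :=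
  ∏ i : Fin n, ∏ j : Fin n,
    if i < j ∧ σ j < σ i then Int.negOnePow (p (σ i) * p (σ j)) else 1

/-- The element `v₁ ⋯ vₙ = ∑_σ ε(σ; p) v_{σ(1)} ⊗ ⋯ ⊗ v_{σ(n)}` of the tensor coalgebra, for
homogeneous `vᵢ` of degree `pᵢ`. -/
noncomputable def symProd (F : Type*) [Field F] {V : Type*} [AddCommGroup V] [Module F V]
    {n : ℕ} (p : Fin n → ℤ) (v : Fin n → V) : ⨂[F]^n V :=
  ∑ σ : Equiv.Perm (Fin n), koszulSign σ p • PiTensorProduct.tprod F (fun i => v (σ i))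

/-- The component `Sᶜ_n[V]` of the graded symmetric coalgebra on the graded space `(V, 𝒱)`,
inside the component `V^{⊗ n}` of the tensor coalgebra: the graded symmetric tensors, which are
spanned by the elements `v₁ ⋯ vₙ`. -/
def SymCoalg (𝒱 : ℤ → Submodule F V) (n : ℕ) : Submodule F (⨂[F]^n V) :=
  Submodule.span F
    {t | ∃ (p : Fin n → ℤ) (v : Fin n → V), (∀ i, v i ∈ 𝒱 (p i)) ∧ t = symProd F p v}

/-- The component `V^{⊗ n} → V^{⊗ i} ⊗ V^{⊗ j}`, `i + j = n`, of the (deconcatenation) coproduct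
of the tensor coalgebra. On `Sᶜ[V]`, a subcoalgebra, it is the coproduct of `Sᶜ[V]`. -/
noncomputable def deconcat {i j n : ℕ} (hn : i + j = n) :
    (⨂[F]^n V) →ₗ[F] (⨂[F]^i V) ⊗[F] (⨂[F]^j V) :=
  (TensorPower.mulEquiv (R := F) (M := V) (n := i) (m := j) :
      (⨂[F]^i V) ⊗[F] (⨂[F]^j V) ≃ₗ[F] ⨂[F]^(i + j) V).symm.toLinearMap ∘ₗ
    (TensorPower.cast F V hn.symm).toLinearMap

/-- The universal twisting cochain (component on `n` tensor factors)
`sx ↦ x` for one tensor factor, and zero for any other number of tensor factors. -/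
noncomputable def universalCochain (F V : Type*) [Field F] [AddCommGroup V] [Module F V] :
    (n : ℕ) → (⨂[F]^n V) →ₗ[F] V
  | 1 => (PiTensorProduct.subsingletonEquiv (R := F) (s := fun _ : Fin 1 => V) (0 : Fin 1)).toLinearMap
  | _ => 0

end SymmetricCoalgebra

section Algebras

variable {F : Type*} [Field F] {A : Type*} [Ring A] [Algebra F A]

/-- A Gerstenhaber algebra: a graded commutative associative unital algebra with a graded Lie
bracket of degree `-1` (a graded Lie bracket for the degrees lowered by one), such that
bracketing with a homogeneous element `a` is a derivation of degree `|a| - 1`. -/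
structure GerstenhaberAlgebra (𝒜 : ℤ → Submodule F A) [GradedAlgebra 𝒜] where
  mul_comm : ∀ i j, ∀ a ∈ 𝒜 i, ∀ b ∈ 𝒜 j, a * b = Int.negOnePow (i * j) • (b * a)
  bracket : A →ₗ[F] A →ₗ[F] A
  bracket_mem : ∀ i j, ∀ a ∈ 𝒜 i, ∀ b ∈ 𝒜 j, bracket a b ∈ 𝒜 (i + j - 1)
  skew : ∀ i j, ∀ a ∈ 𝒜 i, ∀ b ∈ 𝒜 j,
    bracket a b = -(Int.negOnePow ((i - 1) * (j - 1)) • bracket b a)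
  jacobi : ∀ i j, ∀ a ∈ 𝒜 i, ∀ b ∈ 𝒜 j, ∀ c, bracket a (bracket b c) =
    bracket (bracket a b) c + Int.negOnePow ((i - 1) * (j - 1)) • bracket b (bracket a c)
  poisson : ∀ i j, ∀ a ∈ 𝒜 i, ∀ b ∈ 𝒜 j, ∀ c, bracket a (b * c) =
    bracket a b * c + Int.negOnePow ((i - 1) * j) • (b * bracket a c)

/-- A differential Gerstenhaber algebra: `d` is a differential of degree `+1` and a derivation of
the multiplication. -/
structure DiffGerstenhaberAlgebra (𝒜 : ℤ → Submodule F A) [GradedAlgebra 𝒜]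
    extends GerstenhaberAlgebra 𝒜 where
  d : A →ₗ[F] A
  d_mem : ∀ i, ∀ a ∈ 𝒜 i, d a ∈ 𝒜 (i + 1)
  d_d : ∀ a, d (d a) = 0
  d_mul : ∀ i, ∀ a ∈ 𝒜 i, ∀ b, d (a * b) = d a * b + Int.negOnePow i • (a * d b)

/-- A differential BV-algebra `(A, Δ, d)`: a differential Gerstenhaber algebra with an operator
`Δ` (`delta`) of degree `-1` that generates the bracket, with `Δ² = 0` and `Δ d + d Δ = 0`. -/
structure DiffBVAlgebra (𝒜 : ℤ → Submodule F A) [GradedAlgebra 𝒜]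
    extends DiffGerstenhaberAlgebra 𝒜 where
  delta : A →ₗ[F] A
  delta_mem : ∀ i, ∀ a ∈ 𝒜 i, delta a ∈ 𝒜 (i - 1)
  delta_delta : ∀ a, delta (delta a) = 0
  generator : ∀ i, ∀ a ∈ 𝒜 i, ∀ b, bracket a b =
    Int.negOnePow i • (delta (a * b) - delta a * b - Int.negOnePow i • (a * delta b))
  delta_d : ∀ a, delta (d a) + d (delta a) = 0

/-- The grading of the differential graded Lie algebra `g` underlying `A`: `g_p = A^{1-p}`. -/
def lieGrading (𝒜 : ℤ → Submodule F A) (p : ℤ) : Submodule F A := 𝒜 (1 - p)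

/-- `g̃ = ⨁_{n ≥ 0} g_{-n}`, that is, the sum of the `A^{n+1}` for `n ≥ 0`. -/
def gTilde (𝒜 : ℤ → Submodule F A) : Submodule F A := ⨆ n : ℕ, lieGrading 𝒜 (-(n : ℤ))

/-- The linear map with `a ↦ (-1)^n a` for `a ∈ A^n`. -/
noncomputable def signMap (𝒜 : ℤ → Submodule F A) [GradedAlgebra 𝒜] : A →ₗ[F] A :=
  DirectSum.toModule F ℤ A (fun n => ((Int.negOnePow n : ℤ) : F) • (𝒜 n).subtype) ∘ₗ
    (DirectSum.decomposeLinearEquiv 𝒜).toLinearMap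

theorem signMap_of_mem (𝒜 : ℤ → Submodule F A) [GradedAlgebra 𝒜] {n : ℤ} {a : A}
    (ha : a ∈ 𝒜 n) : signMap 𝒜 a = Int.negOnePow n • a := by
  simp only [signMap, LinearMap.comp_apply, LinearEquiv.coe_coe,
    DirectSum.decomposeLinearEquiv_apply, DirectSum.decompose_of_mem 𝒜 ha]
  rw [← DirectSum.lof_eq_of F, DirectSum.toModule_lof]
  rcases Int.even_or_odd n with h | h
  · simp [Int.negOnePow_even n h]
  · simp [Int.negOnePow_odd n h]

namespace DiffBVAlgebra

variable {𝒜 : ℤ → Submodule F A} [GradedAlgebra 𝒜] (B : DiffBVAlgebra 𝒜)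

/-- The space `m = ker Δ`. -/
abbrev m : Submodule F A := LinearMap.ker B.delta

theorem d_mem_m {x : A} (hx : x ∈ B.m) : B.d x ∈ B.m := by
  have h := B.delta_d x
  rw [LinearMap.mem_ker] at hx ⊢
  rwa [hx, map_zero, add_zero] at h

/-- The differential `d` restricted to `m = ker Δ`. -/
def dm : ↥B.m →ₗ[F] ↥B.m := B.d.restrict (fun _ hx => B.d_mem_m hx)

/-- The grading of `m` induced by the one of `g`. -/
def mGrading (p : ℤ) : Submodule F ↥B.m := (lieGrading 𝒜 p).submoduleOf B.m

theorem delta_signMap (a : A) : B.delta (signMap 𝒜 a) = -signMap 𝒜 (B.delta a) := by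
  induction a using DirectSum.Decomposition.inductionOn 𝒜 with
  | zero => simp
  | @homogeneous i a =>
    rw [signMap_of_mem 𝒜 a.2, signMap_of_mem 𝒜 (B.delta_mem i a a.2)]
    rcases Int.even_or_odd i with h | h
    · simp [Int.negOnePow_even i h, Int.negOnePow_odd (i - 1) (h.sub_odd odd_one)]
    · simp [Int.negOnePow_odd i h, Int.negOnePow_even (i - 1) (h.sub_odd odd_one)]
  | add a b ha hb => simp only [map_add, ha, hb, neg_add]

theorem bracket_eq (a b : A) : B.bracket a b =
    B.delta (signMap 𝒜 a * b) - B.delta (signMap 𝒜 a) * b - a * B.delta b := by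
  induction a using DirectSum.Decomposition.inductionOn 𝒜 with
  | zero => simp
  | @homogeneous i a =>
    rw [B.generator i a a.2, signMap_of_mem 𝒜 a.2]
    rcases Int.even_or_odd i with h | h
    · simp [Int.negOnePow_even i h]
    · simp [Int.negOnePow_odd i h]
      abel
  | add a a' ha ha' =>
    simp only [map_add, add_mul, LinearMap.add_apply, ha, ha']
    abel

theorem signMap_mem_m {x : A} (hx : x ∈ B.m) : signMap 𝒜 x ∈ B.m := by
  rw [LinearMap.mem_ker] at hx ⊢
  rw [B.delta_signMap, hx, map_zero, neg_zero]

theorem bracket_mem_m {x y : A} (hx : x ∈ B.m) (hy : y ∈ B.m) : B.bracket x y ∈ B.m := by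
  have h := LinearMap.mem_ker.1 (B.signMap_mem_m hx)
  rw [LinearMap.mem_ker] at hy ⊢
  rw [B.bracket_eq, h, hy, zero_mul, mul_zero, sub_zero, sub_zero, B.delta_delta]

/-- The Lie bracket of `g` restricted to the Lie subalgebra `m = ker Δ`. -/
def mBracket : ↥B.m →ₗ[F] ↥B.m →ₗ[F] ↥B.m :=
  LinearMap.mk₂ F (fun x y => ⟨B.bracket x y, B.bracket_mem_m x.2 y.2⟩)
    (fun x x' y => Subtype.ext (by simp)) (fun c x y => Subtype.ext (by simp))
    (fun x y y' => Subtype.ext (by simp)) (fun c x y => Subtype.ext (by simp))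

/-- The sign map `a ↦ (-1)^n a`, `a ∈ A^n`, restricted to `m = ker Δ`. -/
noncomputable def mSign : ↥B.m →ₗ[F] ↥B.m :=
  (signMap 𝒜).restrict (fun _ hx => B.signMap_mem_m hx)

/-- The homology `H(g) = H(g, d)`. -/
abbrev H : Type _ := Homology B.d

/-- The grading of `H(g)`: `H_p(g)` consists of the classes of the cycles in `g_p`. -/
abbrev HGrading : ℤ → Submodule F B.H := Homology.grading (lieGrading 𝒜) B.d

/-- The map on homology induced by the inclusion `(ker Δ, d) → (g, d)`. -/
def inclHomology : Homology B.dm →ₗ[F] B.H :=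
  Homology.map (dM := B.dm) (dN := B.d) B.m.subtype (fun _ => rfl)

/-- The map on homology `H(ker Δ, d) → H(g, Δ)` induced by the projection
`ker Δ → H(g, Δ)`, when the latter is a chain map for the zero differential on `H(g, Δ)`. -/
def projHomology (hc : ∀ x, Homology.cls B.delta (B.dm x) = 0) :
    Homology B.dm →ₗ[F] Homology B.delta :=
  Submodule.liftQ _ (Homology.cls B.delta ∘ₗ (LinearMap.ker B.dm).subtype) (by
    rintro x ⟨y, hy⟩
    rw [LinearMap.mem_ker, LinearMap.comp_apply]
    exact (congrArg _ hy.symm).trans (hc y))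

/-- The statement of the Kählerian Formality Lemma (`∂∂̄`-lemma): the inclusion
`(ker Δ, d) → (g, d)` and the projection `(ker Δ, d) → (H(g, Δ), 0)` are chain maps that are
isomorphisms on the homology. -/
structure KahlerFormality : Prop where
  proj_chain : ∀ x, Homology.cls B.delta (B.dm x) = 0
  incl_bijective : Function.Bijective B.inclHomology
  proj_bijective : Function.Bijective (B.projHomology proj_chain)

variable {B}

/-- The projection `ker Δ → H(g, Δ)`, viewed as a map `m → H(g)` through the isomorphisms
`H(g, Δ) ≅ H(ker Δ, d) ≅ H(g, d)` of the Kählerian Formality Lemma. -/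
noncomputable def KahlerFormality.proj (hK : B.KahlerFormality) : ↥B.m →ₗ[F] B.H :=
  (LinearEquiv.ofBijective _ hK.incl_bijective).toLinearMap ∘ₗ
    (LinearEquiv.ofBijective _ hK.proj_bijective).symm.toLinearMap ∘ₗ Homology.cls B.delta

variable (B)

/-- Contractions of `m = (ker Δ, d)` onto `(H(g), 0)`. -/
abbrev HContraction : Type _ := Contraction B.HGrading 0 B.mGrading B.dm

/-- The component `Sᶜ_n[sH(g)]` of the graded symmetric coalgebra on the suspension of `H(g)`. -/
abbrev SymH (n : ℕ) : Submodule F (⨂[F]^n B.H) := SymCoalg (suspension B.HGrading) n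

/-- The cup bracket `[ , ] ∘ (f ⊗ k) ∘ (coproduct)`, for components `f`, `k` of maps of degree
`-1` from the tensor coalgebra on `sH(g)` to `m`; on graded symmetric tensors this is the cup
bracket of the restrictions of `f` and `k` to `Sᶜ[sH(g)]`. In
`(f ⊗ k)(x ⊗ y) = (-1)^{|k||x|} f(x) ⊗ k(y)` the sign is `(-1)^{|x|}`, and if `|x| = 2 - n` then
`f(x)` lies in `g_{1-n} = A^n`, so that the sign is the one of `signMap`. -/
noncomputable def cupBracket {i j n : ℕ} (hn : i + j = n)
    (f : (⨂[F]^i B.H) →ₗ[F] ↥B.m) (k : (⨂[F]^j B.H) →ₗ[F] ↥B.m) : (⨂[F]^n B.H) →ₗ[F] ↥B.m :=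
  TensorProduct.lift B.mBracket ∘ₗ TensorProduct.map (B.mSign ∘ₗ f) k ∘ₗ deconcat hn

variable {B}

/-- The components `τ_n` of the map `τ` determined by a contraction, through
`τ_1 = ∇ ∘ (universal twisting cochain)` and, for `n ≥ 2`,
`τ_n = -½ h ([τ_1, τ_{n-1}] + ⋯ + [τ_{n-1}, τ_1])`, before restriction to the symmetric
coalgebra. (With `d h + h d = ∇ π - id`, the minus sign is the one for which
`d τ = ½ [τ, τ]`.) -/
noncomputable def tensorCochain (C : B.HContraction) : (n : ℕ) → (⨂[F]^n B.H) →ₗ[F] ↥B.m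
  | 0 => 0
  | 1 => C.incl ∘ₗ universalCochain F B.H 1
  | n + 2 => -((2⁻¹ : F) • (C.h ∘ₗ ∑ i : Fin (n + 1),
      B.cupBracket (i := i.1 + 1) (j := n + 1 - i.1) (n := n + 2) (by omega)
        (tensorCochain C (i.1 + 1)) (tensorCochain C (n + 1 - i.1))))
  termination_by n => n
  decreasing_by all_goals omega

/-- The component `τ_n : Sᶜ_n[sH(g)] → m ⊆ g` of the map `τ` determined by a contraction. -/
noncomputable def tau (C : B.HContraction) (n : ℕ) : ↥(B.SymH n) →ₗ[F] ↥B.m :=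
  (tensorCochain C n).domRestrict (B.SymH n)

/-- The component on `Sᶜ_n[sH(g)]` of the cup bracket `[τ, τ]`. -/
noncomputable def tauBracket (C : B.HContraction) (n : ℕ) : ↥(B.SymH n) →ₗ[F] ↥B.m :=
  (∑ ij : ↥(Finset.HasAntidiagonal.antidiagonal n), B.cupBracket (Finset.HasAntidiagonal.mem_antidiagonal.1 ij.2)
    (tensorCochain C ij.1.1) (tensorCochain C ij.1.2)).domRestrict (B.SymH n)

end DiffBVAlgebra

end Algebras

end BVFormality

/-! Two facts about `m = Ker Δ` carry the theorem. The kernel of `proj : m → H(g)` is exactly `Im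
Δ`, because `proj` is the passage to the class in `H(g, Δ)` followed by isomorphisms
(`KahlerFormality.proj_eq_zero`). And on `m` the bracket is `[x, y] = Δ(± x y)`
(`mBracket_eq_delta`), so brackets of elements of `m` are killed by `proj`.

A contraction with `π = proj` exists because over a field one can choose, degree by degree, a
section of `π` by cycles and a generalized inverse of `d`; the formality hypothesis makes `Ker π`
acyclic, and an algebraic correction then gives the homotopy and its side conditions. Every such
contraction has the required properties.

The master equation is proved by induction. Write `β` for the component of `[τ, τ]` at the current
stage. The equation at smaller stages and the Jacobi identity give `d β = 0`, and `π β = 0` by the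
second fact, so `d h + h d = ∇ π - id` yields `d h β = -β` and hence `d τ_k = ½ β`. To keep the
Koszul signs under control, `τ` is evaluated on products of homogeneous elements indexed by a finite
set: it becomes a family `X S` indexed by subsets, and the cup bracket becomes a signed sum over
subsets (`orderedSum_deconcat`, `cupSquare`).

For `k ≥ 2` the values of `τ_k` lie in `Im h ⊆ Ker π = Im Δ`. Finally `Im Δ ⊆ g̃`: otherwise `1`
would be `Δ`-exact, so `proj 1 = 0`; but `1` is a `d`-cycle in `m`, so its class in `H(g)` would
vanish and `1` would be `d` of an element of `A^{-1} = 0`. The assumption `H_1(g) ≠ 0` guarantees `1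
≠ 0`. -/

namespace BVFormality

/-! ### Graded linear choices, graded homology and contractions over a field. -/

section GradedLinearAlgebra

variable {F : Type*} [Field F]
variable {M : Type*} [AddCommGroup M] [Module F M]
variable {N : Type*} [AddCommGroup N] [Module F N]

/-- A linear relation that is solvable degree by degree on a graded subspace has a linear graded
selection. -/
theorem exists_graded_selection {ι : Type*} [DecidableEq ι] (𝒩 : ι → Submodule F N)
    [DirectSum.Decomposition 𝒩] (ℳ : ι → Submodule F M) (R : Submodule F (M × N))
    (Y : Submodule F N) (hY : ∀ y ∈ Y, ∀ i, (DirectSum.decompose 𝒩 y i : N) ∈ Y)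
    (hR : ∀ i, ∀ y ∈ 𝒩 i, y ∈ Y → ∃ x ∈ ℳ i, (x, y) ∈ R) :
    ∃ s : N →ₗ[F] M, (∀ i, ∀ y ∈ 𝒩 i, s y ∈ ℳ i) ∧ ∀ y ∈ Y, (s y, y) ∈ R := by
  have key : ∀ i, ∃ s : N →ₗ[F] ↥(ℳ i), ∀ y ∈ 𝒩 i, y ∈ Y → ((s y : M), y) ∈ R := by
    intro i
    let G : Submodule F (M × N) := (ℳ i).prod (𝒩 i ⊓ Y) ⊓ R
    let f : ↥G →ₗ[F] ↥(𝒩 i ⊓ Y) := (LinearMap.snd F M N).restrict (fun x hx => hx.1.2)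
    have hf : LinearMap.range f = ⊤ := by
      rw [LinearMap.range_eq_top]
      rintro ⟨y, hy⟩
      obtain ⟨x, hx, hxy⟩ := hR i y hy.1 hy.2
      exact ⟨⟨(x, y), ⟨hx, hy⟩, hxy⟩, rfl⟩
    -- In degree `i`, a linear section of the projection from the relation onto its second
    -- coordinate is already a selection; it only remains to extend it from `𝒩 i ⊓ Y` to `N`.
    obtain ⟨g, hg⟩ := f.exists_rightInverse_of_surjective hf
    let fst : ↥G →ₗ[F] ↥(ℳ i) := (LinearMap.fst F M N).restrict (fun x hx => hx.1.1)
    obtain ⟨s, hs⟩ := LinearMap.exists_extend (fst ∘ₗ g)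
    refine ⟨s, fun y hy hyY => ?_⟩
    have h1 : s y = fst (g ⟨y, hy, hyY⟩) := LinearMap.congr_fun hs ⟨y, hy, hyY⟩
    have h2 : ((g ⟨y, hy, hyY⟩ : ↥G) : M × N).2 = y :=
      congrArg Subtype.val (LinearMap.congr_fun hg ⟨y, hy, hyY⟩)
    have h3 : ((s y : M), y) = ((g ⟨y, hy, hyY⟩ : ↥G) : M × N) :=
      Prod.ext (congrArg Subtype.val h1) h2.symm
    rw [h3]
    exact (g ⟨y, hy, hyY⟩).2.2
  choose s hs using key
  let S : N →ₗ[F] M := DirectSum.toModule F ι M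
    (fun i => (ℳ i).subtype ∘ₗ s i ∘ₗ (𝒩 i).subtype) ∘ₗ
      (DirectSum.decomposeLinearEquiv 𝒩).toLinearMap
  have hS : ∀ i, ∀ y ∈ 𝒩 i, S y = s i y := by
    intro i y hy
    simp only [S, LinearMap.comp_apply, LinearEquiv.coe_coe,
      DirectSum.decomposeLinearEquiv_apply, DirectSum.decompose_of_mem 𝒩 hy]
    rw [← DirectSum.lof_eq_of F, DirectSum.toModule_lof]
    rfl
  refine ⟨S, fun i y hy => hS i y hy ▸ (s i y).2, fun y hy => ?_⟩
  classical
  have hsum := DirectSum.sum_support_decompose 𝒩 y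
  have : (S y, y) = ∑ i ∈ DFinsupp.support (DirectSum.decompose 𝒩 y),
      (S (DirectSum.decompose 𝒩 y i : N), (DirectSum.decompose 𝒩 y i : N)) := by
    refine Prod.ext ?_ ?_
    · rw [Prod.fst_sum, ← map_sum, hsum]
    · rw [Prod.snd_sum, hsum]
  rw [this]
  refine Submodule.sum_mem _ fun i _ => ?_
  rw [hS i _ (DirectSum.decompose 𝒩 y i).2]
  exact hs i _ (DirectSum.decompose 𝒩 y i).2 (hY y hy i)

theorem decompose_map (𝒩 : ℤ → Submodule F N) [DirectSum.Decomposition 𝒩] {k : ℤ}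
    {T : N →ₗ[F] N} (hT : ∀ i, ∀ x ∈ 𝒩 i, T x ∈ 𝒩 (i + k)) (x : N) (n : ℤ) :
    (DirectSum.decompose 𝒩 (T x) (n + k) : N) = T (DirectSum.decompose 𝒩 x n) := by
  induction x using DirectSum.Decomposition.inductionOn 𝒩 with
  | zero => simp
  | @homogeneous i a =>
    by_cases h : i = n
    · subst h
      rw [DirectSum.decompose_of_mem_same 𝒩 (hT i a a.2), DirectSum.decompose_of_mem_same 𝒩 a.2]
    · rw [DirectSum.decompose_of_mem_ne 𝒩 (hT i a a.2) (by omega),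
        DirectSum.decompose_of_mem_ne 𝒩 a.2 h, map_zero]
  | add a b ha hb => simp [DirectSum.decompose_add, ha, hb]

theorem decompose_mem_ker (𝒩 : ℤ → Submodule F N) [DirectSum.Decomposition 𝒩] {k : ℤ}
    {T : N →ₗ[F] N} (hT : ∀ i, ∀ x ∈ 𝒩 i, T x ∈ 𝒩 (i + k)) {x : N} (hx : x ∈ LinearMap.ker T)
    (n : ℤ) : (DirectSum.decompose 𝒩 x n : N) ∈ LinearMap.ker T := by
  rw [LinearMap.mem_ker] at hx ⊢
  rw [← decompose_map 𝒩 hT, hx, DirectSum.decompose_zero]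
  rfl

theorem Homology.cls_eq_zero {d : N →ₗ[F] N} {z : ↥(LinearMap.ker d)} :
    Homology.cls d z = 0 ↔ ∃ y, d y = z := by
  rw [Homology.cls, Submodule.mkQ_apply, Submodule.Quotient.mk_eq_zero]
  rfl

theorem Homology.cls_surjective (d : N →ₗ[F] N) : Function.Surjective (Homology.cls d) :=
  Submodule.mkQ_surjective _

/-- Since `d` is homogeneous, the projections of `N` to its components preserve cycles and
boundaries and descend to operators `P n` on homology. These read off the components of a sum of
homogeneous classes, which gives injectivity; decomposing a representing cycle gives surjectivity.
-/
theorem Homology.isInternal_grading (𝒩 : ℤ → Submodule F N) [DirectSum.Decomposition 𝒩] {k : ℤ}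
    {d : N →ₗ[F] N} (hd : ∀ i, ∀ x ∈ 𝒩 i, d x ∈ 𝒩 (i + k)) :
    DirectSum.IsInternal (Homology.grading 𝒩 d) := by
  let pr : ℤ → N →ₗ[F] N := fun n => (𝒩 n).subtype ∘ₗ DirectSum.component F ℤ _ n ∘ₗ
    (DirectSum.decomposeLinearEquiv 𝒩).toLinearMap
  have hpr : ∀ n x, pr n x = DirectSum.decompose 𝒩 x n := fun _ _ => rfl
  let prK : ∀ n, ↥(LinearMap.ker d) →ₗ[F] ↥(LinearMap.ker d) := fun n =>
    (pr n).restrict (fun x hx => decompose_mem_ker 𝒩 hd hx n)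
  let P : ℤ → Homology d →ₗ[F] Homology d := fun n =>
    Submodule.mapQ _ _ (prK n) (by
      rintro x ⟨y, hy⟩
      refine ⟨pr (n - k) y, ?_⟩
      have := decompose_map 𝒩 hd y (n - k)
      rw [sub_add_cancel, hy] at this
      exact this.symm)
  have hP : ∀ n z, P n (Homology.cls d z) = Homology.cls d (prK n z) := fun _ _ => rfl
  have hPs : ∀ n, ∀ y ∈ Homology.grading 𝒩 d n, P n y = y := by
    rintro n _ ⟨z, hz, rfl⟩
    rw [hP]
    congr 1
    exact Subtype.ext (DirectSum.decompose_of_mem_same 𝒩 hz)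
  have hPn : ∀ i n, i ≠ n → ∀ y ∈ Homology.grading 𝒩 d i, P n y = 0 := by
    rintro i n hin _ ⟨z, hz, rfl⟩
    rw [hP]
    have : prK n z = 0 := Subtype.ext (DirectSum.decompose_of_mem_ne 𝒩 hz hin)
    rw [this, map_zero]
  constructor
  · have key : ∀ (n : ℤ) (x : ⨁ i, ↥(Homology.grading 𝒩 d i)),
        P n (DirectSum.coeAddMonoidHom (Homology.grading 𝒩 d) x) = x n := by
      intro n x
      induction x using DirectSum.induction_on with
      | zero => simp
      | of i y =>
        rw [DirectSum.coeAddMonoidHom_of]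
        by_cases h : i = n
        · subst h
          rw [hPs i y y.2, DirectSum.of_eq_same]
        · rw [hPn i n h y y.2, DirectSum.of_eq_of_ne _ _ _ (Ne.symm h)]
          rfl
      | add x y hx hy => simp [hx, hy]
    intro x y hxy
    refine DFinsupp.ext fun n => Subtype.ext ?_
    rw [← key, ← key]
    exact congrArg (P n) hxy
  · intro y
    obtain ⟨z, rfl⟩ := Homology.cls_surjective d y
    classical
    have hz : z = ∑ i ∈ DFinsupp.support (DirectSum.decompose 𝒩 (z : N)), prK i z := by
      refine Subtype.ext ?_
      rw [AddSubmonoidClass.coe_finsetSum]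
      exact (DirectSum.sum_support_decompose 𝒩 (z : N)).symm
    refine ⟨∑ i ∈ DFinsupp.support (DirectSum.decompose 𝒩 (z : N)),
      DirectSum.of (fun i => ↥(Homology.grading 𝒩 d i)) i
        ⟨Homology.cls d (prK i z), prK i z, (DirectSum.decompose 𝒩 (z : N) i).2, rfl⟩, ?_⟩
    rw [map_sum]
    simp only [DirectSum.coeAddMonoidHom_of]
    rw [← map_sum, ← hz]

/-- A graded section `∇` of `π` with values in the cycles, and a graded generalized inverse `q`
of the differential, give a contraction as soon as the kernel of `π` is acyclic. -/
theorem exists_contraction {ℳ : ℤ → Submodule F M} {𝒩 : ℤ → Submodule F N} {d : N →ₗ[F] N}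
    (hdeg : ∀ p, ∀ x ∈ 𝒩 p, d x ∈ 𝒩 (p - 1)) (hdd : ∀ x, d (d x) = 0)
    (π : N →ₗ[F] M) (hπ : ∀ p, ∀ x ∈ 𝒩 p, π x ∈ ℳ p) (hπd : ∀ x, π (d x) = 0)
    (i : M →ₗ[F] N) (hi : ∀ p, ∀ y ∈ ℳ p, i y ∈ 𝒩 p) (hdi : ∀ y, d (i y) = 0)
    (hπi : ∀ y, π (i y) = y)
    (q : N →ₗ[F] N) (hq : ∀ p, ∀ x ∈ 𝒩 p, q x ∈ 𝒩 (p + 1)) (hdqd : ∀ x, d (q (d x)) = d x)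
    (hex : ∀ x, π x = 0 → d x = 0 → ∃ w, d w = x) :
    ∃ C : Contraction ℳ 0 𝒩 d, C.proj = π := by
  -- `e = id - i π` is the projection onto `Ker π` along the image of `i`. Conjugating by it (`r = e
  -- q e`) makes `r` vanish on that image and take values in `Ker π`, while `d r d = d` is kept.
  obtain ⟨e, he⟩ : ∃ e : N →ₗ[F] N, ∀ x, e x = x - i (π x) :=
    ⟨LinearMap.id - i ∘ₗ π, fun _ => rfl⟩
  have hed : ∀ x, e (d x) = d x := fun x => by rw [he, hπd, map_zero, sub_zero]
  have hde : ∀ x, d (e x) = d x := fun x => by rw [he, map_sub, hdi, sub_zero]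
  have hπe : ∀ x, π (e x) = 0 := fun x => by rw [he, map_sub, hπi, sub_self]
  have hei : ∀ y, e (i y) = 0 := fun y => by rw [he, hπi, sub_self]
  have hee : ∀ x, e (e x) = e x := fun x => by rw [he (e x), hπe, map_zero, sub_zero]
  have hedeg : ∀ p, ∀ x ∈ 𝒩 p, e x ∈ 𝒩 p := fun p x hx => by
    rw [he]; exact Submodule.sub_mem _ hx (hi p _ (hπ p x hx))
  obtain ⟨r, hr⟩ : ∃ r : N →ₗ[F] N, ∀ x, r x = e (q (e x)) := ⟨e ∘ₗ q ∘ₗ e, fun _ => rfl⟩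
  have hdrd : ∀ x, d (r (d x)) = d x := fun x => by rw [hr, hde, hed, hdqd]
  have her : ∀ x, e (r x) = r x := fun x => by rw [hr, hee]
  have hre : ∀ x, r (e x) = r x := fun x => by rw [hr, hee, hr]
  have hrdeg : ∀ p, ∀ x ∈ 𝒩 p, r x ∈ 𝒩 (p + 1) := fun p x hx => by
    rw [hr]; exact hedeg _ _ (hq _ _ (hedeg _ _ hx))
  have hcyc : ∀ x, π x = 0 → d x = 0 → d (r x) = x := fun x h1 h2 => by
    obtain ⟨w, rfl⟩ := hex x h1 h2
    exact hdrd w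
  -- `e x - r (d x)` is a cycle in `Ker π`, hence fixed by `d r`.
  have hsplit : ∀ x, e x - r (d x) = d (r x) - d (r (r (d x))) := fun x => by
    rw [← map_sub, ← hre x, ← map_sub]
    refine (hcyc _ ?_ ?_).symm
    · rw [map_sub, hπe, ← her, hπe, sub_zero]
    · rw [map_sub, hde, hdrd, sub_self]
  -- The correction `d r r` absorbs the error term of `hsplit`, so that `d s + s d = e`.
  obtain ⟨s, hs⟩ : ∃ s : N →ₗ[F] N, ∀ x, s x = r x - d (r (r x)) :=
    ⟨r - d ∘ₗ r ∘ₗ r, fun _ => rfl⟩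
  have hhom : ∀ x, d (s x) + s (d x) = e x := fun x => by
    rw [hs, hs, map_sub, hdd, sub_zero, sub_eq_iff_eq_add.1 (hsplit x)]
    abel
  have hes : ∀ x, e (s x) = s x := fun x => by rw [hs, map_sub, her, hed]
  have hsi : ∀ y, s (i y) = 0 := fun y => by
    rw [hs, ← hre, hei]; simp
  have hsdeg : ∀ p, ∀ x ∈ 𝒩 p, s x ∈ 𝒩 (p + 1) := fun p x hx => by
    rw [hs]
    refine Submodule.sub_mem _ (hrdeg _ _ hx) ?_
    have := hdeg _ _ (hrdeg _ _ (hrdeg _ _ hx))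
    rwa [add_sub_cancel_right] at this
  have h1 : ∀ x, s (d (s x)) = s x - d (s (s x)) := fun x => by
    rw [eq_sub_iff_add_eq', hhom, hes]
  have h2 : ∀ x, d (s (d (s x))) = d (s x) := fun x => by rw [h1, map_sub, hdd, sub_zero]
  have h3 : ∀ x, s (d (s (d x))) = s (d x) := fun x => by
    have := hhom (d x)
    rw [hdd, map_zero, add_zero, hed] at this
    rw [this]
  have h4 : ∀ x, s (s (d x)) = d (s (s x)) := fun x => by
    rw [← sub_eq_of_eq_add' (hhom x).symm, map_sub, h1, he, map_sub, hsi]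
    abel
  refine ⟨{
    proj := π
    incl := i
    -- Replacing `s` by `s d s` keeps the homotopy identity, by `h2` and `h3`, and forces square
    -- zero: `s s d = d s s` by `h4`, so `d d` appears. The minus sign matches the convention `∇ π -
    -- id`.
    h := -(s ∘ₗ d ∘ₗ s)
    proj_mem := hπ
    incl_mem := hi
    h_mem := fun p x hx => ?_
    proj_comm := fun x => hπd x
    incl_comm := fun y => by rw [hdi]; simp
    proj_incl := hπi
    homotopy := fun x => ?_
    proj_h := fun x => ?_
    h_incl := fun y => by simp [hsi]
    h_h := fun x => ?_ }, rfl⟩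
  · refine Submodule.neg_mem _ ?_
    have := hsdeg _ _ (hdeg _ _ (hsdeg _ _ hx))
    rwa [add_sub_cancel_right] at this
  · simp only [LinearMap.neg_apply, LinearMap.comp_apply, map_neg, h2, h3]
    rw [← neg_add, hhom, he]; abel
  · simp only [LinearMap.neg_apply, LinearMap.comp_apply, map_neg]
    rw [← hes, hπe, neg_zero]
  · simp only [LinearMap.neg_apply, LinearMap.comp_apply, map_neg, neg_neg]
    rw [h4, hdd, map_zero]

end GradedLinearAlgebra
end BVFormality

namespace BVFormality

/-! ### Consequences of the formality hypothesis: the contraction, and `Im Δ ⊆ g̃`. -/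

section Formality

variable {F : Type*} [Field F] {A : Type*} [Ring A] [Algebra F A]

namespace DiffBVAlgebra

variable {𝒜 : ℤ → Submodule F A} [GradedAlgebra 𝒜] (B : DiffBVAlgebra 𝒜)

theorem decompose_d (x : A) (n : ℤ) :
    (DirectSum.decompose 𝒜 (B.d x) n : A) = B.d (DirectSum.decompose 𝒜 x (n - 1)) := by
  have := decompose_map 𝒜 (T := B.d) (k := 1) B.d_mem x (n - 1)
  rwa [sub_add_cancel] at this

theorem decompose_delta (x : A) (n : ℤ) :
    (DirectSum.decompose 𝒜 (B.delta x) n : A) = B.delta (DirectSum.decompose 𝒜 x (n + 1)) := by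
  have := decompose_map 𝒜 (T := B.delta) (k := -1) B.delta_mem x (n + 1)
  rwa [add_neg_cancel_right] at this

theorem decompose_mem_m {x : A} (hx : x ∈ B.m) (n : ℤ) :
    (DirectSum.decompose 𝒜 x n : A) ∈ B.m :=
  decompose_mem_ker 𝒜 (T := B.delta) (k := -1) B.delta_mem hx n

theorem coe_dm (x : ↥B.m) : (B.dm x : A) = B.d x := rfl

theorem dm_dm (x : ↥B.m) : B.dm (B.dm x) = 0 := Subtype.ext (B.d_d x)

theorem mem_mGrading {p : ℤ} {x : ↥B.m} : x ∈ B.mGrading p ↔ (x : A) ∈ 𝒜 (1 - p) := Iff.rfl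

theorem dm_mem (p : ℤ) (x : ↥B.m) (hx : x ∈ B.mGrading p) : B.dm x ∈ B.mGrading (p - 1) := by
  rw [mem_mGrading] at hx ⊢
  have := B.d_mem _ _ hx
  rwa [show 1 - p + 1 = 1 - (p - 1) by ring] at this

variable {B}

namespace KahlerFormality

/-- `x` and the `d`-cycle `z` have the same `Δ`-class, so the class in `H(m)` corresponding to `x`
is that of `z`. This is how `proj` is computed in practice. -/
theorem proj_eq_of_delta (hK : B.KahlerFormality) {x z : ↥B.m} (hz : B.d z = 0) (a : A) (hxz : (x : A) = z + B.delta a) :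
    hK.proj x = Homology.cls B.d ⟨z, hz⟩ := by
  have hx : Homology.cls B.delta x = B.projHomology hK.proj_chain
      (Homology.cls B.dm ⟨z, Subtype.ext hz⟩) := by
    change _ = Homology.cls B.delta z
    rw [← sub_eq_zero, ← map_sub, Homology.cls_eq_zero]
    exact ⟨a, by rw [Submodule.coe_sub, hxz, add_sub_cancel_left]⟩
  simp only [proj, LinearMap.comp_apply, LinearEquiv.coe_coe, hx]
  erw [LinearEquiv.ofBijective_symm_apply_apply]
  rfl

theorem proj_of_cycle (hK : B.KahlerFormality) {z : ↥B.m} (hz : B.d z = 0) :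
    hK.proj z = Homology.cls B.d ⟨z, hz⟩ :=
  hK.proj_eq_of_delta hz 0 (by rw [map_zero, add_zero])

/-- This is the surjectivity of `H(m) → H(g, Δ)`. -/
theorem exists_cycle (hK : B.KahlerFormality) (x : ↥B.m) :
    ∃ z : ↥B.m, B.d z = 0 ∧ ∃ a, (x : A) = z + B.delta a := by
  obtain ⟨c, hc⟩ := hK.proj_bijective.2 (Homology.cls B.delta x)
  obtain ⟨z, rfl⟩ := Homology.cls_surjective B.dm c
  change Homology.cls B.delta (z : ↥B.m) = _ at hc
  rw [eq_comm, ← sub_eq_zero, ← map_sub, Homology.cls_eq_zero] at hc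
  obtain ⟨a, ha⟩ := hc
  refine ⟨z, congrArg Subtype.val (LinearMap.mem_ker.1 z.2), a, ?_⟩
  rw [ha, Submodule.coe_sub, add_sub_cancel]

theorem exists_cycle_of_mem (hK : B.KahlerFormality) {p : ℤ} {x : ↥B.m} (hx : x ∈ B.mGrading p) :
    ∃ z ∈ B.mGrading p, B.d z = 0 ∧ ∃ a, (x : A) = z + B.delta a := by
  obtain ⟨z, hz, a, hxa⟩ := hK.exists_cycle x
  refine ⟨⟨_, B.decompose_mem_m z.2 (1 - p)⟩, SetLike.coe_mem (DirectSum.decompose 𝒜 _ _), ?_,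
    DirectSum.decompose 𝒜 a (1 - p + 1), ?_⟩
  · have := B.decompose_d z (1 - p + 1)
    rw [hz, add_sub_cancel_right, DirectSum.decompose_zero] at this
    exact this.symm
  · rw [← B.decompose_delta, ← DirectSum.decompose_of_mem_same 𝒜 (B.mem_mGrading.1 hx), hxa,
      DirectSum.decompose_add]
    rfl

theorem proj_mem (hK : B.KahlerFormality) (p : ℤ) (x : ↥B.m) (hx : x ∈ B.mGrading p) : hK.proj x ∈ B.HGrading p := by
  obtain ⟨z, hzp, hz, a, hxa⟩ := hK.exists_cycle_of_mem hx
  rw [hK.proj_eq_of_delta hz a hxa]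
  exact ⟨⟨z, hz⟩, hzp, rfl⟩

/-- The two maps applied after the `Δ`-class are isomorphisms. Through this lemma `π h = 0` becomes
`Im τ_k ⊆ Im Δ`. -/
theorem proj_eq_zero (hK : B.KahlerFormality) {x : ↥B.m} : hK.proj x = 0 ↔ (x : A) ∈ LinearMap.range B.delta := by
  rw [proj, LinearMap.comp_apply, LinearMap.comp_apply, LinearEquiv.coe_coe, LinearEquiv.coe_coe,
    LinearEquiv.map_eq_zero_iff, LinearEquiv.map_eq_zero_iff, Homology.cls_eq_zero]
  rfl

theorem proj_dm (hK : B.KahlerFormality) (x : ↥B.m) : hK.proj (B.dm x) = 0 := by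
  rw [hK.proj_eq_zero]
  exact Homology.cls_eq_zero.1 (hK.proj_chain x)

/-- The injectivity of `H(m) → H(g, Δ)`: it says that `Ker proj` is acyclic, as the construction of
a contraction requires. -/
theorem exists_dm_eq (hK : B.KahlerFormality) {x : ↥B.m} (h : hK.proj x = 0) (hx : B.dm x = 0) : ∃ w, B.dm w = x := by
  have h0 : B.projHomology hK.proj_chain (Homology.cls B.dm ⟨x, hx⟩) = 0 :=
    Homology.cls_eq_zero.2 (hK.proj_eq_zero.1 h)
  rw [← map_zero (B.projHomology hK.proj_chain)] at h0
  exact Homology.cls_eq_zero.1 (hK.proj_bijective.1 h0)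

/-- Surjectivity of `H(m) → H(g)` gives a cycle in `m`; its component of the right degree still
represents the homogeneous class. -/
theorem exists_lift (hK : B.KahlerFormality) {p : ℤ} {y : B.H} (hy : y ∈ B.HGrading p) :
    ∃ z ∈ B.mGrading p, B.dm z = 0 ∧ hK.proj z = y := by
  obtain ⟨a, ha, rfl⟩ := hy
  obtain ⟨c, hc⟩ := hK.incl_bijective.2 (Homology.cls B.d a)
  obtain ⟨z, rfl⟩ := Homology.cls_surjective B.dm c
  have hz : B.d (z : ↥B.m) = 0 := congrArg Subtype.val (LinearMap.mem_ker.1 z.2)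
  have hc' : Homology.cls B.d ⟨_, hz⟩ = Homology.cls B.d a := hc
  rw [← sub_eq_zero, ← map_sub, Homology.cls_eq_zero] at hc'
  obtain ⟨b, hb⟩ := hc'
  change B.d b = (z : ↥B.m) - (a : A) at hb
  have hzp : B.d (DirectSum.decompose 𝒜 ((z : ↥B.m) : A) (1 - p)) = 0 := by
    have := B.decompose_d (z : ↥B.m) (1 - p + 1)
    rw [hz, add_sub_cancel_right, DirectSum.decompose_zero] at this
    exact this.symm
  refine ⟨⟨_, B.decompose_mem_m (z : ↥B.m).2 (1 - p)⟩, SetLike.coe_mem (DirectSum.decompose 𝒜 _ _), Subtype.ext hzp, ?_⟩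
  rw [hK.proj_of_cycle hzp, ← sub_eq_zero, ← map_sub, Homology.cls_eq_zero]
  refine ⟨DirectSum.decompose 𝒜 b (1 - p - 1), ?_⟩
  rw [← B.decompose_d, hb, DirectSum.decompose_sub]
  change ((DirectSum.decompose 𝒜 ((z : ↥B.m) : A) (1 - p) : A) -
    (DirectSum.decompose 𝒜 (a : A) (1 - p) : A)) = _
  rw [DirectSum.decompose_of_mem_same 𝒜 (show (a : A) ∈ 𝒜 (1 - p) from ha)]
  rfl

theorem exists_contraction (hK : B.KahlerFormality) : ∃ C : B.HContraction, C.proj = hK.proj := by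
  let _ : DirectSum.Decomposition (Homology.grading 𝒜 B.d) :=
    (Homology.isInternal_grading 𝒜 (k := 1) B.d_mem).chooseDecomposition
  have hflip : ∀ p : ℤ, 1 - (1 - p) = p := fun p => by ring
  -- The section `∇`: for each class, choose a cycle in `m` that `proj` sends to it. Degrees are
  -- those of `A`, and `H_p(g)` sits in degree `1 - p`.
  obtain ⟨i, hi, hi'⟩ := exists_graded_selection (Homology.grading 𝒜 B.d)
    (fun n => B.mGrading (1 - n))
    (LinearMap.ker (B.dm ∘ₗ LinearMap.fst F _ _) ⊓
      LinearMap.ker (hK.proj ∘ₗ LinearMap.fst F _ _ - LinearMap.snd F _ _)) ⊤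
    (fun _ _ _ => Submodule.mem_top) (fun n y hy _ => by
      have hy' : y ∈ B.HGrading (1 - n) := by
        change y ∈ Homology.grading 𝒜 B.d (1 - (1 - n))
        rwa [hflip]
      obtain ⟨z, hz, hz1, hz2⟩ := hK.exists_lift hy'
      exact ⟨z, hz, hz1, sub_eq_zero.2 hz2⟩)
  -- The generalized inverse: for each element of `d(m)`, choose a preimage in `m`.
  obtain ⟨q, hq, hq'⟩ := exists_graded_selection 𝒜
    (fun n => (𝒜 (n - 1)).submoduleOf B.m)
    (LinearMap.ker (B.m.subtype ∘ₗ B.dm ∘ₗ LinearMap.fst F _ _ - LinearMap.snd F _ _))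
    (LinearMap.range (B.m.subtype ∘ₗ B.dm))
    (by
      rintro _ ⟨x, rfl⟩ n
      exact ⟨⟨_, B.decompose_mem_m x.2 (n - 1)⟩, (B.decompose_d x n).symm⟩)
    (by
      rintro n _ hn ⟨x, rfl⟩
      refine ⟨⟨_, B.decompose_mem_m x.2 (n - 1)⟩, SetLike.coe_mem (DirectSum.decompose 𝒜 _ _), sub_eq_zero.2 ?_⟩
      exact (B.decompose_d x n).symm.trans (DirectSum.decompose_of_mem_same 𝒜 hn))
  refine BVFormality.exists_contraction B.dm_mem B.dm_dm hK.proj hK.proj_mem hK.proj_dm i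
    (fun p y hy => ?_) (fun y => (hi' y trivial).1) (fun y => sub_eq_zero.1 (hi' y trivial).2)
    (q ∘ₗ B.m.subtype) (fun p x hx => ?_) (fun x => ?_) (fun x => hK.exists_dm_eq)
  · have := hi (1 - p) y hy
    rwa [hflip] at this
  · have := hq (1 - p) x hx
    rwa [show 1 - p - 1 = 1 - (p + 1) by ring] at this
  · exact Subtype.ext (sub_eq_zero.1 (hq' _ ⟨x, rfl⟩))

/-- If `1 = Δ a`, then `proj 1 = 0`. But `d 1 = 0`, so `proj 1` is the `d`-class of `1`; hence `1 =
d b`, and in degree `0` only the component of `b` in `A^{-1} = 0` contributes. -/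
theorem one_notMem_range_delta (hK : B.KahlerFormality) (hneg : 𝒜 (-1) = ⊥) (hone : (1 : A) ≠ 0) :
    (1 : A) ∉ LinearMap.range B.delta := by
  rintro ⟨a, ha⟩
  have hd1 : B.d 1 = 0 := by
    have := B.d_mul 0 1 (SetLike.GradedOne.one_mem) 1
    simpa using this
  have hm : (1 : A) ∈ B.m := by rw [LinearMap.mem_ker, ← ha, B.delta_delta]
  have h0 : hK.proj ⟨1, hm⟩ = 0 := hK.proj_eq_zero.2 ⟨a, ha⟩
  rw [hK.proj_of_cycle hd1, Homology.cls_eq_zero] at h0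
  obtain ⟨b, hb⟩ := h0
  change B.d b = 1 at hb
  have h1 := B.decompose_d b 0
  rw [hb, DirectSum.decompose_of_mem_same 𝒜 SetLike.GradedOne.one_mem] at h1
  have h2 : (DirectSum.decompose 𝒜 b (0 - 1) : A) ∈ 𝒜 (-1) := SetLike.coe_mem _
  rw [hneg, Submodule.mem_bot] at h2
  rw [h2, map_zero] at h1
  exact hone h1

theorem range_delta_le_gTilde (hK : B.KahlerFormality) (hnonneg : ∀ n < 0, 𝒜 n = ⊥)
    (hA0 : 𝒜 0 = Submodule.span F {1}) (hone : (1 : A) ≠ 0) :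
    LinearMap.range B.delta ≤ gTilde 𝒜 := by
  rintro _ ⟨a, rfl⟩
  classical
  rw [← DirectSum.sum_support_decompose 𝒜 (B.delta a)]
  refine Submodule.sum_mem _ fun n _ => ?_
  rcases lt_trichotomy n 0 with hn | rfl | hn
  · have h2 : (DirectSum.decompose 𝒜 (B.delta a) n : A) ∈ 𝒜 n := SetLike.coe_mem _
    rw [(Submodule.eq_bot_iff _).1 (hnonneg n hn) _ h2]
    exact Submodule.zero_mem _
  · have h2 : (DirectSum.decompose 𝒜 (B.delta a) 0 : A) ∈ 𝒜 0 := SetLike.coe_mem _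
    obtain ⟨c, hc⟩ := Submodule.mem_span_singleton.1 (hA0.le h2)
    by_cases h : c = 0
    · rw [← hc, h, zero_smul]
      exact Submodule.zero_mem _
    -- The component of `Δ a` in degree `0` is `c • 1`, and is itself `Δ` of a component of `a`;
    -- with `c ≠ 0` this makes `1` exact.
    · refine absurd ⟨c⁻¹ • DirectSum.decompose 𝒜 a (0 + 1), ?_⟩
        (hK.one_notMem_range_delta (hnonneg (-1) (by norm_num)) hone)
      rw [map_smul, ← B.decompose_delta, ← hc, smul_smul, inv_mul_cancel₀ h, one_smul]
  -- For `n > 0`, `A^n` is `g_{-(n-1)}`.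
  · refine Submodule.mem_iSup_of_mem (n - 1).toNat ?_
    rw [lieGrading, show (1 : ℤ) - -((n - 1).toNat : ℤ) = n by omega]
    exact SetLike.coe_mem _

end KahlerFormality
end DiffBVAlgebra
end Formality
end BVFormality

namespace BVFormality

/-! ### Koszul signs of words, and cochains evaluated on products over finite sets. -/

section OrderedSums

variable {ι : Type*} [LinearOrder ι] (p : ι → ℤ)

/-- The Koszul sign of moving the letters of `U` to the right of those of `T`. -/
def pairSign (T U : Finset ι) : ℤˣ :=
  ∏ s ∈ T, ∏ u ∈ U, if u < s then Int.negOnePow (p s * p u) else 1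

/-- The Koszul sign of a word: one factor for each inversion. -/
def wordSign {k : ℕ} (w : Fin k → ι) : ℤˣ :=
  ∏ a : Fin k, ∏ b : Fin k,
    if a < b ∧ w b < w a then Int.negOnePow (p (w a) * p (w b)) else 1

/-- The words of length `k` that list the elements of `S` without repetition. -/
def words [Fintype ι] (k : ℕ) (S : Finset ι) : Finset (Fin k → ι) :=
  {w | Function.Injective w ∧ Finset.univ.image w = S}

theorem mem_words [Fintype ι] {k : ℕ} {S : Finset ι} {w : Fin k → ι} :
    w ∈ words k S ↔ Function.Injective w ∧ Finset.univ.image w = S := by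
  simp [words]

theorem card_of_mem_words [Fintype ι] {k : ℕ} {S : Finset ι} {w : Fin k → ι} (hw : w ∈ words k S) :
    S.card = k := by
  obtain ⟨h, rfl⟩ := mem_words.1 hw
  rw [Finset.card_image_of_injective _ h, Finset.card_univ, Fintype.card_fin]

theorem append_mem_words [Fintype ι] {i j : ℕ} {S : Finset ι} {w : Fin i → ι} {w' : Fin j → ι} :
    Fin.append w w' ∈ words (i + j) S ↔
      w ∈ words i (Finset.univ.image w) ∧ w' ∈ words j (S \ Finset.univ.image w) ∧
        Finset.univ.image w ⊆ S := by
  simp only [mem_words, and_true, Fin.append_injective_iff]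
  have himg : Finset.univ.image (Fin.append w w') =
      Finset.univ.image w ∪ Finset.univ.image w' := by
    ext x
    simp only [Finset.mem_image, Finset.mem_univ, true_and, Finset.mem_union]
    constructor
    · rintro ⟨a, rfl⟩
      induction a using Fin.addCases with
      | left a => exact Or.inl ⟨a, by simp⟩
      | right a => exact Or.inr ⟨a, by simp⟩
    · rintro (⟨a, rfl⟩ | ⟨a, rfl⟩)
      · exact ⟨Fin.castAdd j a, by simp⟩
      · exact ⟨Fin.natAdd i a, by simp⟩
  rw [himg]
  constructor
  · rintro ⟨⟨h1, h2, h3⟩, rfl⟩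
    refine ⟨h1, ⟨h2, ?_⟩, Finset.subset_union_left⟩
    rw [Finset.union_sdiff_left, Finset.sdiff_eq_self_of_disjoint]
    rw [Finset.disjoint_left]
    simp only [Finset.mem_image, Finset.mem_univ, true_and]
    rintro _ ⟨b, rfl⟩ ⟨a, ha⟩
    exact h3 a b ha
  · rintro ⟨h1, ⟨h2, h3⟩, h4⟩
    refine ⟨⟨h1, h2, fun a b hab => ?_⟩, by rw [h3, Finset.union_sdiff_of_subset h4]⟩
    have : w' b ∈ S \ Finset.univ.image w := by
      rw [← h3]
      exact Finset.mem_image_of_mem _ (Finset.mem_univ _)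
    rw [← hab] at this
    exact (Finset.mem_sdiff.1 this).2 (Finset.mem_image_of_mem _ (Finset.mem_univ _))

/-- An inversion of the concatenated word lies within `w`, within `w'`, or across the cut. -/
theorem wordSign_append {i j : ℕ} {w : Fin i → ι} {w' : Fin j → ι}
    (hw : Function.Injective w) (hw' : Function.Injective w') :
    wordSign p (Fin.append w w') = wordSign p w * wordSign p w' *
      pairSign p (Finset.univ.image w) (Finset.univ.image w') := by
  have hlt : ∀ (a : Fin i) (b : Fin j), Fin.castAdd j a < Fin.natAdd i b := fun a b => by
    rw [Fin.lt_def, Fin.val_castAdd, Fin.val_natAdd]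
    omega
  simp only [wordSign, pairSign, Fin.prod_univ_add, Fin.append_left, Fin.append_right,
    Finset.prod_image hw.injOn, Finset.prod_image hw'.injOn, Finset.prod_mul_distrib, hlt,
    (hlt _ _).not_gt, false_and, if_false, true_and, Finset.prod_const_one, mul_one]
  simp only [Fin.lt_def, Fin.val_castAdd, Fin.val_natAdd, add_lt_add_iff_left]
  rw [mul_assoc]
  exact congrArg _ (mul_comm _ _)

theorem pairSign_union_left {T U W : Finset ι} (h : Disjoint T U) :
    pairSign p (T ∪ U) W = pairSign p T W * pairSign p U W :=
  Finset.prod_union h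

theorem pairSign_union_right {T U W : Finset ι} (h : Disjoint U W) :
    pairSign p T (U ∪ W) = pairSign p T U * pairSign p T W := by
  simp only [pairSign, Finset.prod_union h, Finset.prod_mul_distrib]

/-- For disjoint sets each pair `s ∈ T`, `u ∈ U` is inverted in exactly one of the two orders. -/
theorem pairSign_swap {T U : Finset ι} (h : Disjoint T U) :
    pairSign p T U = Int.negOnePow ((∑ i ∈ T, p i) * ∑ i ∈ U, p i) * pairSign p U T := by
  have hsum : Int.negOnePow ((∑ i ∈ T, p i) * ∑ i ∈ U, p i) =
      ∏ s ∈ T, ∏ u ∈ U, Int.negOnePow (p s * p u) := by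
    rw [Finset.sum_mul_sum]
    have hprod : ∀ (S : Finset ι) (f : ι → ℤ),
        Int.negOnePow (∑ i ∈ S, f i) = ∏ i ∈ S, Int.negOnePow (f i) := by
      intro S f
      induction S using Finset.induction_on with
      | empty => simp
      | insert a S ha ih => rw [Finset.sum_insert ha, Finset.prod_insert ha, Int.negOnePow_add, ih]
    simp only [hprod]
  rw [hsum, pairSign, pairSign, Finset.prod_comm (s := U), ← Finset.prod_mul_distrib]
  refine Finset.prod_congr rfl fun s hs => ?_
  rw [← Finset.prod_mul_distrib]
  refine Finset.prod_congr rfl fun u hu => ?_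
  have hne : s ≠ u := fun e => Finset.disjoint_left.1 h hs (e ▸ hu)
  rcases lt_or_gt_of_ne hne with hlt | hlt
  · rw [if_neg hlt.not_gt, if_pos hlt, mul_comm (p u), Int.units_mul_self]
  · rw [if_pos hlt, if_neg hlt.not_gt, mul_one]

variable [Fintype ι] {F : Type*} [Field F]
variable {V : Type*} [AddCommGroup V] [Module F V]
variable {W : Type*} [AddCommGroup W] [Module F W]

/-- The value of `f` on the product of the `v i`, `i ∈ S`, in the graded symmetric coalgebra. -/
noncomputable def orderedSum {k : ℕ} (f : (⨂[F]^k V) →ₗ[F] W) (v : ι → V) (S : Finset ι) : W :=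
  ∑ w ∈ words k S, (wordSign p w : ℤ) • f (PiTensorProduct.tprod F (fun a => v (w a)))

theorem orderedSum_of_card_ne {k : ℕ} (f : (⨂[F]^k V) →ₗ[F] W) (v : ι → V) {S : Finset ι}
    (h : S.card ≠ k) : orderedSum p f v S = 0 := by
  refine Finset.sum_eq_zero fun w hw => absurd (card_of_mem_words hw) h

theorem map_symProd {n : ℕ} (p : Fin n → ℤ) (f : (⨂[F]^n V) →ₗ[F] W) (v : Fin n → V) :
    f (symProd F p v) = orderedSum p f v Finset.univ := by
  rw [symProd, map_sum, orderedSum]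
  refine Finset.sum_bij (fun σ _ => ⇑σ) (fun σ _ => ?_) (fun σ _ τ _ h => ?_) (fun w hw => ?_)
    (fun σ _ => ?_)
  · exact mem_words.2 ⟨σ.injective, Finset.image_univ_equiv σ⟩
  · exact DFunLike.coe_injective h
  · have := (mem_words.1 hw).1
    exact ⟨Equiv.ofBijective w (Finite.injective_iff_bijective.1 this), Finset.mem_univ _, rfl⟩
  · rw [Units.smul_def, map_zsmul]
    rfl

theorem deconcat_tprod {i j : ℕ} (u : Fin (i + j) → V) :
    deconcat (F := F) (rfl : i + j = i + j) (PiTensorProduct.tprod F u) =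
      PiTensorProduct.tprod F (fun a => u (Fin.castAdd j a)) ⊗ₜ[F]
        PiTensorProduct.tprod F (fun b => u (Fin.natAdd i b)) := by
  rw [deconcat, LinearMap.comp_apply, LinearEquiv.coe_coe, LinearEquiv.coe_coe,
    LinearEquiv.symm_apply_eq, TensorPower.cast_refl, LinearEquiv.refl_apply]
  have := TensorPower.tprod_mul_tprod (R := F) (fun a => u (Fin.castAdd j a))
    (fun b => u (Fin.natAdd i b))
  rw [Fin.append_castAdd_natAdd, TensorPower.gMul_def] at this
  exact this.symm

/-- Cutting a word that lists `S` after its first `i` letters amounts to choosing the subset `T` of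
those letters, a word for `T` and a word for `S \ T`. With `wordSign_append` the sign splits
accordingly, so deconcatenation becomes a signed sum over subsets. -/
theorem orderedSum_deconcat {W₁ W₂ : Type*} [AddCommGroup W₁] [Module F W₁] [AddCommGroup W₂]
    [Module F W₂] (β : W₁ →ₗ[F] W₂ →ₗ[F] W) {i j n : ℕ} (hn : i + j = n)
    (f : (⨂[F]^i V) →ₗ[F] W₁) (g : (⨂[F]^j V) →ₗ[F] W₂) (v : ι → V) (S : Finset ι) :
    orderedSum p (TensorProduct.lift β ∘ₗ TensorProduct.map f g ∘ₗ deconcat hn) v S =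
      ∑ T ∈ S.powerset, (pairSign p T (S \ T) : ℤ) •
        β (orderedSum p f v T) (orderedSum p g v (S \ T)) := by
  subst hn
  simp only [orderedSum, map_sum, LinearMap.sum_apply, Finset.smul_sum, LinearMap.comp_apply,
    deconcat_tprod, TensorProduct.map_tmul, TensorProduct.lift.tmul]
  simp only [Finset.sum_sigma']
  refine Finset.sum_bij' (fun w _ => ⟨Finset.univ.image (fun a => w (Fin.castAdd j a)),
      fun b => w (Fin.natAdd i b), fun a => w (Fin.castAdd j a)⟩)
    (fun x _ => Fin.append x.2.2 x.2.1) (fun w hw => ?_) (fun x hx => ?_) (fun w hw => ?_)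
    (fun x hx => ?_) (fun w hw => ?_)
  · rw [← Fin.append_castAdd_natAdd (f := w), append_mem_words] at hw
    simp only [Finset.mem_sigma, Finset.mem_powerset]
    exact ⟨hw.2.2, hw.2.1, hw.1⟩
  · obtain ⟨T, w', w⟩ := x
    simp only [Finset.mem_sigma, Finset.mem_powerset] at hx
    obtain ⟨h1, h2, h3⟩ := hx
    obtain ⟨h4, rfl⟩ := mem_words.1 h3
    exact append_mem_words.2 ⟨h3, h2, h1⟩
  · exact Fin.append_castAdd_natAdd
  · obtain ⟨T, w', w⟩ := x
    simp only [Finset.mem_sigma, Finset.mem_powerset] at hx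
    obtain ⟨h4, rfl⟩ := mem_words.1 hx.2.2
    simp
  · rw [← Fin.append_castAdd_natAdd (f := w), append_mem_words] at hw
    obtain ⟨h1, h2, h3⟩ := hw
    have h2' := mem_words.1 h2
    conv_lhs => rw [← Fin.append_castAdd_natAdd (f := w)]
    rw [wordSign_append p (mem_words.1 h1).1 h2'.1, h2'.2]
    simp only [Units.val_mul, map_zsmul, LinearMap.smul_apply, smul_smul]
    simp only [Fin.append_left, Fin.append_right]
    congr 1
    ring

end OrderedSums
end BVFormality

namespace BVFormality

/-! ### Sums over ordered partitions into three blocks, and their symmetries. -/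

section TripleSums

variable {ι : Type*} [DecidableEq ι] {G : Type*} [AddCommGroup G]

/-- The sum over the ordered partitions of `N` into three blocks. -/
def tripleSum (N : Finset ι) (g : Finset ι → Finset ι → Finset ι → G) : G :=
  ∑ T ∈ N.powerset, ∑ V ∈ (N \ T).powerset, g T V ((N \ T) \ V)

theorem tripleSum_congr {N : Finset ι} {g g' : Finset ι → Finset ι → Finset ι → G}
    (h : ∀ a b c, Disjoint a b → Disjoint a c → Disjoint b c → g a b c = g' a b c) :
    tripleSum N g = tripleSum N g' := by
  refine Finset.sum_congr rfl fun T _ => Finset.sum_congr rfl fun V hV => ?_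
  rw [Finset.mem_powerset] at hV
  have hT : Disjoint T (N \ T) := Finset.disjoint_sdiff
  exact h _ _ _ (hT.mono_right hV) (hT.mono_right Finset.sdiff_subset) Finset.disjoint_sdiff

theorem tripleSum_nested (N : Finset ι) (g : Finset ι → Finset ι → Finset ι → G) :
    ∑ T ∈ N.powerset, ∑ V ∈ T.powerset, g V (T \ V) (N \ T) = tripleSum N g := by
  rw [tripleSum, Finset.sum_sigma', Finset.sum_sigma']
  refine Finset.sum_bij' (fun x _ => ⟨x.2, x.1 \ x.2⟩) (fun x _ => ⟨x.1 ∪ x.2, x.1⟩) ?_ ?_ ?_ ?_ ?_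
  all_goals
    rintro ⟨T, V⟩ h
    simp only [Finset.mem_sigma, Finset.mem_powerset] at h ⊢
  · exact ⟨h.2.trans h.1, Finset.sdiff_subset_sdiff h.1 subset_rfl⟩
  · exact ⟨Finset.union_subset h.1 (h.2.trans Finset.sdiff_subset), Finset.subset_union_left⟩
  · rw [Finset.union_sdiff_of_subset h.2]
  · have : Disjoint T V := Finset.disjoint_sdiff.mono_right h.2
    rw [Finset.union_sdiff_cancel_left this]
  · rw [sdiff_sdiff_left, Finset.sup_eq_union, Finset.union_sdiff_of_subset h.2]

theorem tripleSum_swap_left (N : Finset ι) (g : Finset ι → Finset ι → Finset ι → G) :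
    tripleSum N (fun a b c => g b a c) = tripleSum N g := by
  rw [tripleSum, tripleSum, Finset.sum_sigma', Finset.sum_sigma']
  refine Finset.sum_bij' (fun x _ => ⟨x.2, x.1⟩) (fun x _ => ⟨x.2, x.1⟩) ?_ ?_ ?_ ?_ ?_
  all_goals
    rintro ⟨T, V⟩ h
    simp only [Finset.mem_sigma, Finset.mem_powerset] at h ⊢
  iterate 2
    rw [Finset.subset_sdiff] at h ⊢
    exact ⟨h.2.1, h.1, h.2.2.symm⟩
  rw [sdiff_right_comm]

theorem tripleSum_swap_right (N : Finset ι) (g : Finset ι → Finset ι → Finset ι → G) :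
    tripleSum N (fun a b c => g a c b) = tripleSum N g := by
  refine Finset.sum_congr rfl fun T _ => ?_
  refine Finset.sum_bij' (fun V _ => (N \ T) \ V) (fun V _ => (N \ T) \ V) ?_ ?_ ?_ ?_ ?_
  all_goals
    intro V h
    simp only [Finset.mem_powerset] at h ⊢
  · exact Finset.sdiff_subset
  · exact Finset.sdiff_subset
  · exact Finset.sdiff_sdiff_eq_self h
  · exact Finset.sdiff_sdiff_eq_self h
  · rw [Finset.sdiff_sdiff_eq_self h]

theorem tripleSum_rotate (N : Finset ι) (g : Finset ι → Finset ι → Finset ι → G) :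
    tripleSum N (fun a b c => g c a b) = tripleSum N g := by
  rw [← tripleSum_swap_left N g, ← tripleSum_swap_right N (fun a b c => g b a c)]

theorem tripleSum_add (N : Finset ι) (g g' : Finset ι → Finset ι → Finset ι → G) :
    tripleSum N (fun a b c => g a b c + g' a b c) = tripleSum N g + tripleSum N g' := by
  simp only [tripleSum, Finset.sum_add_distrib]

theorem tripleSum_neg (N : Finset ι) (g : Finset ι → Finset ι → Finset ι → G) :
    tripleSum N (fun a b c => -g a b c) = -tripleSum N g := by
  simp only [tripleSum, Finset.sum_neg_distrib]

end TripleSums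

/-! ### The differential Lie algebra `Ker Δ`, and why `[τ, τ]` is a cycle. -/

section MasterEquation

variable {F : Type*} [Field F] {A : Type*} [Ring A] [Algebra F A]

namespace DiffBVAlgebra

variable {𝒜 : ℤ → Submodule F A} [GradedAlgebra 𝒜] (B : DiffBVAlgebra 𝒜)

theorem coe_mBracket (x y : ↥B.m) : (B.mBracket x y : A) = B.bracket x y := rfl

theorem coe_mSign (x : ↥B.m) : (B.mSign x : A) = signMap 𝒜 x := rfl

theorem signMap_signMap (a : A) : signMap 𝒜 (signMap 𝒜 a) = a := by
  induction a using DirectSum.Decomposition.inductionOn 𝒜 with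
  | zero => simp
  | @homogeneous i a =>
    rw [signMap_of_mem 𝒜 a.2, Units.smul_def, map_zsmul, signMap_of_mem 𝒜 a.2, ← Units.smul_def,
      smul_smul, Int.units_mul_self, one_smul]
  | add a b ha hb => simp only [map_add, ha, hb]

theorem signMap_mul (a b : A) : signMap 𝒜 (a * b) = signMap 𝒜 a * signMap 𝒜 b := by
  induction a using DirectSum.Decomposition.inductionOn 𝒜 with
  | zero => simp
  | @homogeneous i a =>
    induction b using DirectSum.Decomposition.inductionOn 𝒜 with
    | zero => simp
    | @homogeneous j b =>
      rw [signMap_of_mem 𝒜 a.2, signMap_of_mem 𝒜 b.2,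
        signMap_of_mem 𝒜 (SetLike.GradedMul.mul_mem a.2 b.2), Int.negOnePow_add]
      simp only [Units.smul_def, Units.val_mul, smul_mul_smul_comm]
    | add b b' hb hb' => simp only [map_add, mul_add, hb, hb']
  | add a a' ha ha' => simp only [map_add, add_mul, ha, ha']

theorem d_signMap (a : A) : B.d (signMap 𝒜 a) = -signMap 𝒜 (B.d a) := by
  induction a using DirectSum.Decomposition.inductionOn 𝒜 with
  | zero => simp
  | @homogeneous i a =>
    rw [signMap_of_mem 𝒜 a.2, signMap_of_mem 𝒜 (B.d_mem i a a.2), Int.negOnePow_succ]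
    simp only [Units.smul_def, map_zsmul, Units.val_neg, neg_smul, neg_neg]
  | add a b ha hb => simp only [map_add, ha, hb, neg_add]

theorem d_mul' (a b : A) : B.d (a * b) = B.d a * b + signMap 𝒜 a * B.d b := by
  induction a using DirectSum.Decomposition.inductionOn 𝒜 with
  | zero => simp
  | @homogeneous i a =>
    rw [B.d_mul i a a.2, signMap_of_mem 𝒜 a.2, Units.smul_def, Units.smul_def, smul_mul_assoc]
  | add a a' ha ha' =>
    simp only [map_add, add_mul, ha, ha']
    abel

/-- On `Ker Δ` the last two terms of the formula generating the bracket vanish. All brackets in `m`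
are therefore `Δ`-exact. -/
theorem mBracket_eq_delta (x y : ↥B.m) :
    (B.mBracket x y : A) = B.delta (signMap 𝒜 x * (y : A)) := by
  rw [coe_mBracket, B.bracket_eq, LinearMap.mem_ker.1 (B.signMap_mem_m x.2),
    LinearMap.mem_ker.1 y.2, zero_mul, mul_zero, sub_zero, sub_zero]

theorem mSign_mSign (x : ↥B.m) : B.mSign (B.mSign x) = x := Subtype.ext (signMap_signMap _)

theorem dm_mSign (x : ↥B.m) : B.dm (B.mSign x) = -B.mSign (B.dm x) :=
  Subtype.ext (B.d_signMap _)

theorem mSign_mBracket (x y : ↥B.m) :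
    B.mSign (B.mBracket x y) = -B.mBracket (B.mSign x) (B.mSign y) := by
  refine Subtype.ext ?_
  rw [coe_mSign, mBracket_eq_delta, Submodule.coe_neg, mBracket_eq_delta, coe_mSign, coe_mSign,
    ← signMap_mul, B.delta_signMap, neg_neg]

/-- Write the bracket as `Δ` of a product; `d` anticommutes with `Δ` and is a derivation of the
product. -/
theorem dm_mBracket (x y : ↥B.m) :
    B.dm (B.mBracket x y) = B.mBracket (B.dm x) y - B.mBracket (B.mSign x) (B.dm y) := by
  refine Subtype.ext ?_
  rw [coe_dm, mBracket_eq_delta, Submodule.coe_sub, mBracket_eq_delta, mBracket_eq_delta, coe_dm,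
    coe_dm, coe_mSign, ← neg_eq_of_add_eq_zero_right (B.delta_d _), d_mul', d_signMap,
    signMap_signMap, ← map_sub, ← map_neg]
  congr 1
  rw [neg_mul]
  abel

/-- `g_{p-1} = A^{2-p}`, and `2 - p` has the parity of `p`, the degree of the argument in the
suspension. -/
theorem mSign_of_mem {p : ℤ} {x : ↥B.m} (hx : x ∈ B.mGrading (p - 1)) :
    B.mSign x = (Int.negOnePow p : ℤ) • x := by
  refine Subtype.ext ?_
  rw [coe_mSign, signMap_of_mem 𝒜 (B.mem_mGrading.1 hx), Units.smul_def,
    show 1 - (p - 1) = 2 - p by ring, Int.negOnePow_sub, Int.negOnePow_even 2 even_two, one_mul]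
  rfl

theorem mBracket_mem {p q : ℤ} {x y : ↥B.m} (hx : x ∈ B.mGrading p) (hy : y ∈ B.mGrading q) :
    B.mBracket x y ∈ B.mGrading (p + q) := by
  have := B.bracket_mem _ _ x (B.mem_mGrading.1 hx) y (B.mem_mGrading.1 hy)
  rwa [show 1 - p + (1 - q) - 1 = 1 - (p + q) by ring] at this

theorem mBracket_skew {p q : ℤ} {x y : ↥B.m} (hx : x ∈ B.mGrading p) (hy : y ∈ B.mGrading q) :
    B.mBracket x y = -((Int.negOnePow (p * q) : ℤ) • B.mBracket y x) := by
  have := B.skew _ _ x (B.mem_mGrading.1 hx) y (B.mem_mGrading.1 hy)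
  rw [show (1 - p - 1) * (1 - q - 1) = p * q by ring, Units.smul_def] at this
  exact Subtype.ext this

theorem mBracket_jacobi {p q : ℤ} {x y : ↥B.m} (hx : x ∈ B.mGrading p) (hy : y ∈ B.mGrading q)
    (z : ↥B.m) : B.mBracket x (B.mBracket y z) = B.mBracket (B.mBracket x y) z +
      (Int.negOnePow (p * q) : ℤ) • B.mBracket y (B.mBracket x z) := by
  have := B.jacobi _ _ x (B.mem_mGrading.1 hx) y (B.mem_mGrading.1 hy) z
  rw [show (1 - p - 1) * (1 - q - 1) = p * q by ring, Units.smul_def] at this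
  exact Subtype.ext this

variable {ι : Type*} [LinearOrder ι] (p : ι → ℤ)

/-- The coefficient of `[x_a, [x_b, x_c]]` in the triple cup bracket. -/
def tripleSign (a b c : Finset ι) : ℤ :=
  (pairSign p a b * pairSign p a c * pairSign p b c * Int.negOnePow (∑ i ∈ b, p i) : ℤˣ)

/-- The cup bracket `[x, x]` of a family indexed by finite sets. -/
noncomputable def cupSquare (X : Finset ι → ↥B.m) (N : Finset ι) : ↥B.m :=
  ∑ T ∈ N.powerset, (pairSign p T (N \ T) : ℤ) • B.mBracket (B.mSign (X T)) (X (N \ T))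

variable {p}

theorem coe_units_sq (u : ℤˣ) : (u : ℤ) * u = 1 := by
  rw [← Units.val_mul, Int.units_mul_self, Units.val_one]

/-- Let `L` be the sum of the `[[x_a, x_b], x_c]` and `R` that of the `[x_a, [x_b, x_c]]`. Jacobi
and the exchange of `a` and `b` give `L = 2R`; skew symmetry and a rotation of the blocks give `L =
-R`. So `3R = 0`, and in characteristic zero both sums vanish. -/
theorem jacobi_tripleSum [CharZero F] {X : Finset ι → ↥B.m}
    (hX : ∀ S, X S ∈ B.mGrading ((∑ i ∈ S, p i) - 1)) (N : Finset ι) :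
    tripleSum N (fun a b c => tripleSign p a b c • B.mBracket (B.mBracket (X a) (X b)) (X c)) =
      tripleSum N
        (fun a b c => tripleSign p a b c • B.mBracket (X a) (B.mBracket (X b) (X c))) := by
  set g : Finset ι → Finset ι → Finset ι → ↥B.m :=
    fun a b c => tripleSign p a b c • B.mBracket (X a) (B.mBracket (X b) (X c)) with hg
  have h1 : tripleSum N
      (fun a b c => tripleSign p a b c • B.mBracket (B.mBracket (X a) (X b)) (X c)) =
      tripleSum N g + tripleSum N g := by
    nth_rw 2 [← tripleSum_swap_left N g]
    rw [← tripleSum_add]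
    refine tripleSum_congr fun a b c hab _ _ => ?_
    simp only [hg]
    rw [B.mBracket_jacobi (hX a) (hX b), smul_add, add_assoc, left_eq_add, smul_smul, ← add_smul]
    convert zero_smul ℤ _ using 2
    simp only [tripleSign, pairSign_swap p hab]
    have h : Int.negOnePow (((∑ i ∈ a, p i) - 1) * ((∑ i ∈ b, p i) - 1)) =
        -(Int.negOnePow ((∑ i ∈ a, p i) * ∑ i ∈ b, p i) * Int.negOnePow (∑ i ∈ a, p i) *
          Int.negOnePow (∑ i ∈ b, p i)) := by
      rw [show ((∑ i ∈ a, p i) - 1) * ((∑ i ∈ b, p i) - 1) =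
        (∑ i ∈ a, p i) * (∑ i ∈ b, p i) - (∑ i ∈ a, p i) - (∑ i ∈ b, p i) + 1 by ring,
        Int.negOnePow_succ, Int.negOnePow_sub, Int.negOnePow_sub]
    rw [h]
    push_cast
    have e1 := coe_units_sq (Int.negOnePow ((∑ i ∈ a, p i) * ∑ i ∈ b, p i))
    have e2 := coe_units_sq (Int.negOnePow (∑ i ∈ b, p i))
    generalize (Int.negOnePow ((∑ i ∈ a, p i) * ∑ i ∈ b, p i) : ℤ) = u at *
    generalize (Int.negOnePow (∑ i ∈ b, p i) : ℤ) = s at *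
    generalize (Int.negOnePow (∑ i ∈ a, p i) : ℤ) = s' at *
    generalize (pairSign p b a : ℤ) = x at *
    generalize (pairSign p a c : ℤ) = y at *
    generalize (pairSign p b c : ℤ) = z at *
    linear_combination (-x * y * z * s') * (e1 * s * s + e2)
  have h2 : tripleSum N
      (fun a b c => tripleSign p a b c • B.mBracket (B.mBracket (X a) (X b)) (X c)) =
      -tripleSum N g := by
    rw [← tripleSum_rotate N g, ← tripleSum_neg]
    refine tripleSum_congr fun a b c _ hac hbc => ?_
    simp only [hg]
    rw [B.mBracket_skew (B.mBracket_mem (hX a) (hX b)) (hX c), smul_neg, neg_inj, smul_smul]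
    congr 1
    simp only [tripleSign, pairSign_swap p hac, pairSign_swap p hbc]
    have h : Int.negOnePow (((∑ i ∈ a, p i) - 1 + ((∑ i ∈ b, p i) - 1)) * ((∑ i ∈ c, p i) - 1)) =
        Int.negOnePow ((∑ i ∈ a, p i) * ∑ i ∈ c, p i) *
          Int.negOnePow ((∑ i ∈ b, p i) * ∑ i ∈ c, p i) *
            Int.negOnePow (∑ i ∈ a, p i) * Int.negOnePow (∑ i ∈ b, p i) := by
      rw [show ((∑ i ∈ a, p i) - 1 + ((∑ i ∈ b, p i) - 1)) * ((∑ i ∈ c, p i) - 1) =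
        (∑ i ∈ a, p i) * (∑ i ∈ c, p i) + (∑ i ∈ b, p i) * (∑ i ∈ c, p i) - (∑ i ∈ a, p i)
          - (∑ i ∈ b, p i) - 2 * ((∑ i ∈ c, p i) - 1) by ring,
        Int.negOnePow_sub _ (2 * _), Int.negOnePow_two_mul, mul_one, Int.negOnePow_sub,
        Int.negOnePow_sub, Int.negOnePow_add]
    rw [h]
    push_cast
    have e1 := coe_units_sq (Int.negOnePow ((∑ i ∈ a, p i) * ∑ i ∈ c, p i))
    have e2 := coe_units_sq (Int.negOnePow ((∑ i ∈ b, p i) * ∑ i ∈ c, p i))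
    have e3 := coe_units_sq (Int.negOnePow (∑ i ∈ b, p i))
    generalize (Int.negOnePow ((∑ i ∈ a, p i) * ∑ i ∈ c, p i) : ℤ) = u at *
    generalize (Int.negOnePow ((∑ i ∈ b, p i) * ∑ i ∈ c, p i) : ℤ) = t at *
    generalize (Int.negOnePow (∑ i ∈ b, p i) : ℤ) = s at *
    generalize (Int.negOnePow (∑ i ∈ a, p i) : ℤ) = s' at *
    generalize (pairSign p a b : ℤ) = x at *
    generalize (pairSign p c a : ℤ) = y at *
    generalize (pairSign p c b : ℤ) = z at *
    linear_combination (x * y * z * s') * (e1 * t * t * s * s + e2 * s * s + e3)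
  have h3 : (3 : F) • tripleSum N g = 0 := by
    have h4 := h1.symm.trans h2
    rw [← sub_eq_zero, sub_neg_eq_add] at h4
    rw [← h4]
    module
  have h5 := (smul_eq_zero.1 h3).resolve_left (by norm_num)
  rw [h1, h5, add_zero]

/-- Expanding `d [X, X]` and substituting `d X = ½ [X, X]` gives half the difference of the two
iterated cup brackets, which agree by `jacobi_tripleSum`. -/
theorem dm_cupSquare [CharZero F] {X : Finset ι → ↥B.m}
    (hX : ∀ S, X S ∈ B.mGrading ((∑ i ∈ S, p i) - 1)) (hX0 : X ∅ = 0) {N : Finset ι}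
    (hd : ∀ T, T ⊂ N → B.dm (X T) = (2⁻¹ : F) • B.cupSquare p X T) :
    B.dm (B.cupSquare p X N) = 0 := by
  have hcup : ∀ T, B.cupSquare p X T = ∑ V ∈ T.powerset,
      ((pairSign p V (T \ V) : ℤ) * (Int.negOnePow (∑ i ∈ V, p i) : ℤ)) •
        B.mBracket (X V) (X (T \ V)) := fun T => by
    refine Finset.sum_congr rfl fun V _ => ?_
    rw [B.mSign_of_mem (hX V), map_zsmul, LinearMap.smul_apply, smul_smul]
  have hscup : ∀ T, B.mSign (B.cupSquare p X T) = -∑ V ∈ T.powerset,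
      ((pairSign p V (T \ V) : ℤ) * (Int.negOnePow (∑ i ∈ T \ V, p i) : ℤ)) •
        B.mBracket (X V) (X (T \ V)) := fun T => by
    rw [cupSquare, map_sum, ← Finset.sum_neg_distrib]
    refine Finset.sum_congr rfl fun V _ => ?_
    rw [map_zsmul, B.mSign_mBracket, B.mSign_mSign, B.mSign_of_mem (hX (T \ V)), map_zsmul,
      smul_neg, smul_smul]
  -- The only term containing `d (X N)` is bracketed with `X ∅ = 0`, so the equation is needed on
  -- proper subsets only; the same holds for `hr`.
  have hl : ∀ T ∈ N.powerset, B.mBracket (B.mSign (B.dm (X T))) (X (N \ T)) =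
      (2⁻¹ : F) • B.mBracket (B.mSign (B.cupSquare p X T)) (X (N \ T)) := fun T hT => by
    rcases (Finset.mem_powerset.1 hT).eq_or_ssubset with rfl | h
    · rw [Finset.sdiff_self, hX0, map_zero, map_zero, smul_zero]
    · rw [hd T h, map_smul, map_smul, LinearMap.smul_apply]
  have hr : ∀ T ∈ N.powerset, B.mBracket (X T) (B.dm (X (N \ T))) =
      (2⁻¹ : F) • B.mBracket (X T) (B.cupSquare p X (N \ T)) := fun T hT => by
    rcases (Finset.sdiff_subset : N \ T ⊆ N).eq_or_ssubset with h | h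
    · have : T = ∅ := by
        rw [Finset.sdiff_eq_self_iff_disjoint] at h
        exact Finset.disjoint_self_iff_empty T |>.1 (h.mono_left (Finset.mem_powerset.1 hT))
      rw [this, hX0, map_zero, LinearMap.zero_apply, LinearMap.zero_apply, smul_zero]
    · rw [hd _ h, map_smul]
  have hmain : B.dm (B.cupSquare p X N) = (2⁻¹ : F) • (tripleSum N
      (fun a b c => tripleSign p a b c • B.mBracket (B.mBracket (X a) (X b)) (X c)) -
      tripleSum N
        (fun a b c => tripleSign p a b c • B.mBracket (X a) (B.mBracket (X b) (X c)))) := by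
    rw [← tripleSum_nested, tripleSum, ← Finset.sum_sub_distrib, Finset.smul_sum]
    nth_rw 1 [cupSquare]
    rw [map_sum]
    refine Finset.sum_congr rfl fun T hT => ?_
    rw [map_zsmul, B.dm_mBracket, B.dm_mSign, B.mSign_mSign, map_neg, LinearMap.neg_apply,
      hl T hT, hr T hT, hscup, hcup, map_neg, LinearMap.neg_apply, smul_neg, neg_neg,
      ← smul_sub, smul_comm]
    congr 1
    rw [map_sum, map_sum, LinearMap.sum_apply, smul_sub, Finset.smul_sum, Finset.smul_sum]
    congr 1
    · refine Finset.sum_congr rfl fun V hV => ?_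
      rw [Finset.mem_powerset] at hV
      rw [map_zsmul, LinearMap.smul_apply, smul_smul]
      congr 1
      have h : pairSign p T (N \ T) = pairSign p V (N \ T) * pairSign p (T \ V) (N \ T) := by
        rw [← pairSign_union_left p Finset.disjoint_sdiff, Finset.union_sdiff_of_subset hV]
      rw [h, tripleSign]
      push_cast
      ring
    · refine Finset.sum_congr rfl fun V hV => ?_
      rw [Finset.mem_powerset] at hV
      rw [map_zsmul, smul_smul]
      congr 1
      have h : pairSign p T (N \ T) = pairSign p T V * pairSign p T ((N \ T) \ V) := by
        rw [← pairSign_union_right p Finset.disjoint_sdiff, Finset.union_sdiff_of_subset hV]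
      rw [h, tripleSign]
      push_cast
      ring
  rw [hmain, B.jacobi_tripleSum hX, sub_self, smul_zero]

end DiffBVAlgebra
end MasterEquation
end BVFormality

namespace BVFormality

/-! ### The cochain `τ`: degrees, recursion over subsets, master equation. -/

section Cochains

variable {F : Type*} [Field F] {A : Type*} [Ring A] [Algebra F A]

theorem orderedSum_comp {ι : Type*} [Fintype ι] [LinearOrder ι] (p : ι → ℤ)
    {V W W' : Type*} [AddCommGroup V] [Module F V] [AddCommGroup W] [Module F W]
    [AddCommGroup W'] [Module F W'] {k : ℕ} (g : W →ₗ[F] W') (f : (⨂[F]^k V) →ₗ[F] W)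
    (v : ι → V) (S : Finset ι) : orderedSum p (g ∘ₗ f) v S = g (orderedSum p f v S) := by
  simp only [orderedSum, map_sum, map_zsmul, LinearMap.comp_apply]

theorem orderedSum_sum {ι : Type*} [Fintype ι] [LinearOrder ι] (p : ι → ℤ)
    {V W : Type*} [AddCommGroup V] [Module F V] [AddCommGroup W] [Module F W]
    {κ : Type*} (s : Finset κ) {k : ℕ} (f : κ → (⨂[F]^k V) →ₗ[F] W) (v : ι → V) (S : Finset ι) :
    orderedSum p (∑ c ∈ s, f c) v S = ∑ c ∈ s, orderedSum p (f c) v S := by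
  simp only [orderedSum, LinearMap.sum_apply, Finset.smul_sum]
  exact Finset.sum_comm

namespace DiffBVAlgebra

variable {𝒜 : ℤ → Submodule F A} [GradedAlgebra 𝒜] {B : DiffBVAlgebra 𝒜}

theorem tensorCochain_zero (C : B.HContraction) : tensorCochain C 0 = 0 := by
  rw [tensorCochain]

theorem tensorCochain_one (C : B.HContraction) :
    tensorCochain C 1 = C.incl ∘ₗ universalCochain F B.H 1 := by
  rw [tensorCochain]

theorem tensorCochain_add_two (C : B.HContraction) (n : ℕ) :
    tensorCochain C (n + 2) = (-((2⁻¹ : F) • C.h)) ∘ₗ ∑ i : Fin (n + 1),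
      B.cupBracket (i := i.1 + 1) (j := n + 1 - i.1) (n := n + 2) (by omega)
        (tensorCochain C (i.1 + 1)) (tensorCochain C (n + 1 - i.1)) := by
  rw [tensorCochain, LinearMap.neg_comp, LinearMap.smul_comp]

theorem cupBracket_tprod_mem {i j n : ℕ} (hn : i + j = n)
    {f : (⨂[F]^i B.H) →ₗ[F] ↥B.m} {k : (⨂[F]^j B.H) →ₗ[F] ↥B.m}
    (hf : ∀ (p : Fin i → ℤ) (v : Fin i → B.H), (∀ a, v a ∈ suspension B.HGrading (p a)) →
      f (PiTensorProduct.tprod F v) ∈ B.mGrading ((∑ a, p a) - 1))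
    (hk : ∀ (p : Fin j → ℤ) (v : Fin j → B.H), (∀ a, v a ∈ suspension B.HGrading (p a)) →
      k (PiTensorProduct.tprod F v) ∈ B.mGrading ((∑ a, p a) - 1))
    (p : Fin n → ℤ) (v : Fin n → B.H) (hv : ∀ a, v a ∈ suspension B.HGrading (p a)) :
    B.cupBracket hn f k (PiTensorProduct.tprod F v) ∈ B.mGrading ((∑ a, p a) - 2) := by
  subst hn
  rw [cupBracket, LinearMap.comp_apply, LinearMap.comp_apply, deconcat_tprod,
    TensorProduct.map_tmul, TensorProduct.lift.tmul, LinearMap.comp_apply]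
  have h1 := hf (fun a => p (Fin.castAdd j a)) (fun a => v (Fin.castAdd j a)) fun a => hv _
  have h2 := hk (fun a => p (Fin.natAdd i a)) (fun a => v (Fin.natAdd i a)) fun a => hv _
  rw [B.mSign_of_mem h1, map_zsmul, LinearMap.smul_apply, Fin.sum_univ_add]
  have := B.mBracket_mem h1 h2
  rw [show ∀ x y : ℤ, x - 1 + (y - 1) = x + y - 2 by intros; ring] at this
  exact zsmul_mem this _

theorem tensorCochain_tprod_mem (C : B.HContraction) : ∀ (n : ℕ) (p : Fin n → ℤ)
    (v : Fin n → B.H), (∀ a, v a ∈ suspension B.HGrading (p a)) →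
      tensorCochain C n (PiTensorProduct.tprod F v) ∈ B.mGrading ((∑ a, p a) - 1) := by
  intro n
  induction n using Nat.strong_induction_on with
  | _ n ih =>
    intro p v hv
    match n with
    | 0 =>
      rw [tensorCochain_zero, LinearMap.zero_apply]
      exact Submodule.zero_mem _
    | 1 =>
      rw [tensorCochain_one, LinearMap.comp_apply, universalCochain, LinearEquiv.coe_coe,
        PiTensorProduct.subsingletonEquiv_apply_tprod, Fin.sum_univ_one]
      exact C.incl_mem _ _ (hv 0)
    | n + 2 =>
      rw [tensorCochain_add_two, LinearMap.comp_apply, LinearMap.neg_apply, LinearMap.smul_apply,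
        LinearMap.sum_apply]
      refine Submodule.neg_mem _ (Submodule.smul_mem _ _ ?_)
      have := C.h_mem ((∑ a, p a) - 2) _ (Submodule.sum_mem (t := Finset.univ) _
        fun (i : Fin (n + 1)) _ => cupBracket_tprod_mem (show i.1 + 1 + (n + 1 - i.1) = n + 2 by omega)
          (ih (i.1 + 1) (by omega)) (ih (n + 1 - i.1) (by omega)) p v hv)
      rwa [show (∑ a, p a) - 2 + 1 = (∑ a, p a) - 1 by ring] at this

theorem orderedSum_tensorCochain_mem (C : B.HContraction) {ι : Type*} [Fintype ι] [LinearOrder ι]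
    {p : ι → ℤ} {v : ι → B.H} (hv : ∀ a, v a ∈ suspension B.HGrading (p a)) (n : ℕ)
    (S : Finset ι) :
    orderedSum p (tensorCochain C n) v S ∈ B.mGrading ((∑ i ∈ S, p i) - 1) := by
  refine Submodule.sum_mem _ fun w hw => zsmul_mem ?_ _
  obtain ⟨h1, rfl⟩ := mem_words.1 hw
  rw [Finset.sum_image h1.injOn]
  exact tensorCochain_tprod_mem C n _ _ fun a => hv _

theorem orderedSum_cupBracket {ι : Type*} [Fintype ι] [LinearOrder ι] (p : ι → ℤ) {i j n : ℕ}
    (hn : i + j = n) (f : (⨂[F]^i B.H) →ₗ[F] ↥B.m) (k : (⨂[F]^j B.H) →ₗ[F] ↥B.m) (v : ι → B.H)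
    (S : Finset ι) : orderedSum p (B.cupBracket hn f k) v S =
      ∑ T ∈ S.powerset, (pairSign p T (S \ T) : ℤ) •
        B.mBracket (B.mSign (orderedSum p f v T)) (orderedSum p k v (S \ T)) := by
  rw [cupBracket, orderedSum_deconcat]
  refine Finset.sum_congr rfl fun T _ => ?_
  rw [orderedSum_comp]

/-- The values of `τ` on the products of the `v i`, `i ∈ S`. -/
noncomputable def tauFamily (C : B.HContraction) {ι : Type*} [Fintype ι] [LinearOrder ι]
    (p : ι → ℤ) (v : ι → B.H) (S : Finset ι) : ↥B.m :=
  orderedSum p (tensorCochain C S.card) v S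

/-- For a fixed `T` only the pair `(T.card, (S \ T).card)` contributes, since the other ordered sums
run over no words. -/
theorem sum_antidiagonal_eq_cupSquare (C : B.HContraction) {ι : Type*} [Fintype ι]
    [LinearOrder ι] (p : ι → ℤ) (v : ι → B.H) {n : ℕ} {S : Finset ι} (hS : S.card = n) :
    ∑ ij ∈ Finset.HasAntidiagonal.antidiagonal n, ∑ T ∈ S.powerset, (pairSign p T (S \ T) : ℤ) •
        B.mBracket (B.mSign (orderedSum p (tensorCochain C ij.1) v T))
          (orderedSum p (tensorCochain C ij.2) v (S \ T)) =
      B.cupSquare p (tauFamily C p v) S := by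
  rw [Finset.sum_comm]
  refine Finset.sum_congr rfl fun T hT => ?_
  rw [← Finset.smul_sum, Finset.sum_eq_single (T.card, (S \ T).card)]
  · rfl
  · rintro ⟨i, j⟩ _ hij
    by_cases h : T.card = i
    · have h' : (S \ T).card ≠ j := fun h' => hij (by rw [h, h'])
      rw [orderedSum_of_card_ne p _ _ h', map_zero]
    · rw [orderedSum_of_card_ne p _ _ h, map_zero, map_zero, LinearMap.zero_apply]
  · intro h
    refine absurd ?_ h
    rw [Finset.HasAntidiagonal.mem_antidiagonal, ← hS, add_comm]
    exact Finset.card_sdiff_add_card_eq_card (Finset.mem_powerset.1 hT)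

theorem orderedSum_tensorCochain_zero (C : B.HContraction) {ι : Type*} [Fintype ι]
    [LinearOrder ι] (p : ι → ℤ) (v : ι → B.H) (S : Finset ι) :
    orderedSum p (tensorCochain C 0) v S = 0 := by
  rw [tensorCochain_zero, orderedSum]
  simp only [LinearMap.zero_apply, smul_zero, Finset.sum_const_zero]

theorem tauFamily_empty (C : B.HContraction) {ι : Type*} [Fintype ι] [LinearOrder ι]
    (p : ι → ℤ) (v : ι → B.H) : tauFamily C p v ∅ = 0 := by
  rw [tauFamily, Finset.card_empty]
  exact orderedSum_tensorCochain_zero C p v ∅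

theorem orderedSum_tensorCochain (C : B.HContraction) {ι : Type*} [Fintype ι] [LinearOrder ι]
    (p : ι → ℤ) (v : ι → B.H) {n : ℕ} {S : Finset ι} (hS : S.card = n + 2) :
    orderedSum p (tensorCochain C (n + 2)) v S =
      -((2⁻¹ : F) • C.h (B.cupSquare p (tauFamily C p v) S)) := by
  rw [tensorCochain_add_two, orderedSum_comp, orderedSum_sum, LinearMap.neg_apply,
    LinearMap.smul_apply, ← sum_antidiagonal_eq_cupSquare C p v hS,
    Finset.Nat.sum_antidiagonal_eq_sum_range_succ (fun i j => ∑ T ∈ S.powerset,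
      (pairSign p T (S \ T) : ℤ) • B.mBracket (B.mSign (orderedSum p (tensorCochain C i) v T))
          (orderedSum p (tensorCochain C j) v (S \ T))) (n + 2),
    Finset.sum_range_succ, Finset.sum_range_succ', Nat.sub_self]
  -- The two ends of the antidiagonal involve `τ_0 = 0`; what remains are the terms of the
  -- recursion.
  simp only [orderedSum_tensorCochain_zero, map_zero, LinearMap.zero_apply, smul_zero, Finset.sum_const_zero, add_zero]
  rw [Finset.sum_range]
  refine congrArg (fun x => -((2⁻¹ : F) • C.h x)) (Finset.sum_congr rfl fun i _ => ?_)
  rw [orderedSum_cupBracket, show n + 2 - (i.1 + 1) = n + 1 - i.1 by omega]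

theorem proj_cupSquare (hK : B.KahlerFormality) {ι : Type*} [LinearOrder ι] (p : ι → ℤ)
    (X : Finset ι → ↥B.m) (S : Finset ι) : hK.proj (B.cupSquare p X S) = 0 := by
  rw [cupSquare, map_sum]
  refine Finset.sum_eq_zero fun T _ => ?_
  rw [map_zsmul, hK.proj_eq_zero.2 ⟨_, (B.mBracket_eq_delta _ _).symm⟩, smul_zero]

/-- Induction on `S`. For at most one element both sides vanish. Otherwise `β = cupSquare` is a
cycle by induction and `π β = 0` because brackets are `Δ`-exact, so the homotopy identity reads `d h
β = -β`. -/
theorem dm_tauFamily [CharZero F] (hK : B.KahlerFormality) (C : B.HContraction)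
    (hC : C.proj = hK.proj) {ι : Type*} [Fintype ι] [LinearOrder ι]
    {p : ι → ℤ} {v : ι → B.H} (hv : ∀ a, v a ∈ suspension B.HGrading (p a)) (S : Finset ι) :
    B.dm (tauFamily C p v S) = (2⁻¹ : F) • B.cupSquare p (tauFamily C p v) S := by
  have h0 := tauFamily_empty C p v
  induction S using Finset.strongInduction with
  | H S ih =>
    match hS : S.card with
    | 0 =>
      rw [Finset.card_eq_zero.1 hS, h0, cupSquare, Finset.powerset_empty, Finset.sum_singleton,
        h0, map_zero, map_zero, map_zero, LinearMap.zero_apply, smul_zero, smul_zero]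
    | 1 =>
      have h1 : B.cupSquare p (tauFamily C p v) S = 0 := by
        refine Finset.sum_eq_zero fun T hT => ?_
        obtain ⟨a, rfl⟩ := Finset.card_eq_one.1 hS
        rcases Finset.subset_singleton_iff.1 (Finset.mem_powerset.1 hT) with rfl | rfl
        · rw [h0, map_zero, map_zero, LinearMap.zero_apply, smul_zero]
        · rw [Finset.sdiff_self, h0, map_zero, smul_zero]
      rw [h1, smul_zero, tauFamily, hS, tensorCochain_one, orderedSum_comp, ← C.incl_comm,
        LinearMap.zero_apply, map_zero]
    | n + 2 =>
      have hβ := C.homotopy (B.cupSquare p (tauFamily C p v) S)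
      rw [B.dm_cupSquare (X := tauFamily C p v) (fun T => orderedSum_tensorCochain_mem C hv _ T) h0 ih, map_zero,
        add_zero, hC, proj_cupSquare, map_zero, zero_sub] at hβ
      nth_rw 1 [tauFamily]
      rw [hS, orderedSum_tensorCochain C p v hS, map_neg, map_smul, hβ, smul_neg, neg_neg]

theorem dm_tensorCochain [CharZero F] (hK : B.KahlerFormality) (C : B.HContraction)
    (hC : C.proj = hK.proj) (n : ℕ) (t : ↥(B.SymH n)) :
    B.dm (tau C n t) = (2⁻¹ : F) • tauBracket C n t := by
  obtain ⟨t, ht⟩ := t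
  rw [tau, tauBracket, LinearMap.domRestrict_apply, LinearMap.domRestrict_apply]
  refine LinearMap.eqOn_span' (f := B.dm ∘ₗ tensorCochain C n) (g := (2⁻¹ : F) • _) ?_ ht
  rintro _ ⟨p, v, hv, rfl⟩
  rw [LinearMap.comp_apply, LinearMap.smul_apply, map_symProd, map_symProd, orderedSum_sum]
  have hcard : (Finset.univ : Finset (Fin n)).card = n := by simp
  have h1 := dm_tauFamily hK C hC hv Finset.univ
  rw [tauFamily, hcard] at h1
  rw [h1, ← sum_antidiagonal_eq_cupSquare C p v hcard, ← Finset.sum_coe_sort]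
  refine congrArg _ (Finset.sum_congr rfl fun ij _ => ?_)
  rw [orderedSum_cupBracket]

end DiffBVAlgebra
end Cochains
end BVFormality

/-! ### The main theorem. -/

theorem mainTheorem5 {F : Type*} [Field F] [CharZero F] {A : Type*} [Ring A] [Algebra F A]
    (𝒜 : ℤ → Submodule F A) [GradedAlgebra 𝒜]
    (hnonneg : ∀ n < 0, 𝒜 n = ⊥)
    (B : BVFormality.DiffBVAlgebra 𝒜)
    (hK : B.KahlerFormality)
    (hA0 : 𝒜 0 = Submodule.span F {1})
    (hdelta1 : B.delta 1 = 0)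
    (hH1 : B.HGrading 1 ≠ ⊥) :
    ∃ C : B.HContraction, C.proj = hK.proj ∧
      -- `τ` is homogeneous of degree `-1`
      (∀ (n : ℕ) (p : Fin n → ℤ) (v : Fin n → B.H),
        (∀ i, v i ∈ BVFormality.suspension B.HGrading (p i)) →
        ∀ t : ↥(B.SymH n), (t : PiTensorProduct F fun _ : Fin n => B.H) =
          BVFormality.symProd F p v →
        ((BVFormality.DiffBVAlgebra.tau C n t : ↥B.m) : A) ∈
          BVFormality.lieGrading 𝒜 ((∑ i, p i) - 1)) ∧
      -- `τ` solves the master equation `d τ = ½ [τ, τ]`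
      (∀ (n : ℕ) (t : ↥(B.SymH n)),
        B.d (BVFormality.DiffBVAlgebra.tau C n t : ↥B.m) =
          (2⁻¹ : F) • ((BVFormality.DiffBVAlgebra.tauBracket C n t : ↥B.m) : A)) ∧
      -- `Δ ∘ τ = 0`
      (∀ (n : ℕ) (t : ↥(B.SymH n)),
        B.delta (BVFormality.DiffBVAlgebra.tau C n t : ↥B.m) = 0) ∧
      -- `π ∘ τ` is the universal twisting cochain
      (∀ (n : ℕ) (t : ↥(B.SymH n)),
        C.proj (BVFormality.DiffBVAlgebra.tau C n t) =
          BVFormality.universalCochain F B.H n t) ∧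
      -- `Im τ_k ⊆ Im Δ` and `Im τ_k ⊆ g̃` for `k ≥ 2`
      (∀ k : ℕ, 2 ≤ k → ∀ t : ↥(B.SymH k),
        ((BVFormality.DiffBVAlgebra.tau C k t : ↥B.m) : A) ∈ LinearMap.range B.delta ∧
        ((BVFormality.DiffBVAlgebra.tau C k t : ↥B.m) : A) ∈ BVFormality.gTilde 𝒜) := by
  -- In the zero ring every homology class is zero, contrary to `H_1(g) ≠ 0`.
  have hone : (1 : A) ≠ 0 := by
    intro h
    refine hH1 ((Submodule.eq_bot_iff _).2 ?_)
    rintro _ ⟨z, _, rfl⟩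
    have hz : z = 0 := Subtype.ext (by rw [← mul_one (z : A), h, mul_zero]; rfl)
    rw [hz, map_zero]
  obtain ⟨C, hC⟩ := hK.exists_contraction
  refine ⟨C, hC, fun n p v hv t ht => ?_, fun n t => ?_, fun n t => ?_, fun n t => ?_,
    fun k hk t => ?_⟩
  · have := BVFormality.DiffBVAlgebra.orderedSum_tensorCochain_mem C hv n Finset.univ
    rw [← BVFormality.map_symProd, ← ht] at this
    exact this
  · exact congrArg Subtype.val (BVFormality.DiffBVAlgebra.dm_tensorCochain hK C hC n t)
  · exact LinearMap.mem_ker.1 (BVFormality.DiffBVAlgebra.tau C n t).2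
  · rw [BVFormality.DiffBVAlgebra.tau, LinearMap.domRestrict_apply]
    match n with
    | 0 =>
      rw [BVFormality.DiffBVAlgebra.tensorCochain_zero, LinearMap.zero_apply, map_zero]
      rfl
    | 1 =>
      rw [BVFormality.DiffBVAlgebra.tensorCochain_one, LinearMap.comp_apply, C.proj_incl]
    | n + 2 =>
      rw [BVFormality.DiffBVAlgebra.tensorCochain_add_two, LinearMap.comp_apply,
        LinearMap.neg_apply, LinearMap.smul_apply, map_neg, map_smul, C.proj_h, smul_zero,
        neg_zero]
      rfl
  -- For `k ≥ 2`, `τ_k` takes values in the image of `h`, and `π h = 0` with `Ker π = Im Δ`.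
  · have h : ((BVFormality.DiffBVAlgebra.tau C k t : ↥B.m) : A) ∈ LinearMap.range B.delta := by
      obtain ⟨n, rfl⟩ := Nat.exists_eq_add_of_le' hk
      rw [← hK.proj_eq_zero, ← hC, BVFormality.DiffBVAlgebra.tau, LinearMap.domRestrict_apply,
        BVFormality.DiffBVAlgebra.tensorCochain_add_two, LinearMap.comp_apply,
        LinearMap.neg_apply, LinearMap.smul_apply, map_neg, map_smul, C.proj_h, smul_zero,
        neg_zero]
    exact ⟨h, hK.range_delta_le_gTilde hnonneg hA0 hone h⟩
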